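/- Let $k$ be an algebraically closed field of characteristic $0$, and let $G$ be a connected semisimple linear algebraic group over $k$, that is, a Zariski closed connected subgroup of some $GL_n(k)$ whose Lie algebra $\mathfrak g$ is semisimple. Let $\mathfrak t\subset\mathfrak g$ be a Cartan subalgebra, let $\mathfrak u$ be the sum of the root spaces of the positive roots with respect to a chosen base of the root system of $(\mathfrak g,\mathfrak t)$, let $\mathfrak b=\mathfrak t\oplus\mathfrak u$ be the corresponding Borel subalgebra, and let $B\subset G$ be the corresponding Borel subgroup, i.e. the connected closed subgroup with Lie algebra $\mathfrak b$. The adjoint representation makes $\mathfrak g/\mathfrak b$ (which is identified, as a vector space, with the sum $\mathfrak u^-$ of the negative root spaces) a $B$-module; write $s\cdot\eta$ for the action of $s\in B$ and $b\circ\eta$ for the action of $b\in\mathfrak b$ on $\eta\in\mathfrak g/\mathfrak b$. Let $\mathfrak q=\mathfrak b\ltimes(\mathfrak g/\mathfrak b)^a$, where $(\mathfrak g/\mathfrak b)^a$ is regarded as an abelian ideal, and let $Q=B\ltimes\exp((\mathfrak g/\mathfrak b)^a)$ be the corresponding connected group, whose adjoint representation on $\mathfrak q$ is $$\mathrm{Ad}_Q(s\exp(\eta))(b,\eta')=\bigl(\mathrm{Ad}(s)b,\;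 s\cdot(\eta'-b\circ\eta)\bigr)\qquad(s\in B,\ b\in\mathfrak b,\ \eta,\eta'\in\mathfrak g/\mathfrak b).$$ Let $\pi_Q:\mathfrak q\to\mathfrak t$ be the linear map $(t+u,\eta)\mapsto t$ ($t\in\mathfrak t$, $u\in\mathfrak u$, $\eta\in\mathfrak g/\mathfrak b$). Then $p\mapsto p\circ\pi_Q$ is an isomorphism of $k$-algebras from $k[\mathfrak t]$ onto the algebra $k[\mathfrak q]^Q$ of $Q$-invariant polynomial functions on $\mathfrak q$; in other words, $\pi_Q$ is the quotient morphism $\mathfrak q\to\operatorname{Spec}k[\mathfrak q]^Q\simeq\mathfrak t$. In particular $k[\mathfrak q]^Q$ is a polynomial ring in $\dim\mathfrak t$ generators of degree $1$: for every basis $\varphi_1,\dots,\varphi_l$ of $\mathfrak t^*$, the linear functions $\varphi_1\circ\pi_Q,\dots,\varphi_l\circ\pi_Q$ are algebraically independent and generate $k[\mathfrak q]^Q$. -/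

import Mathlib

open scoped MatrixGroups

attribute [local instance] LieRing.ofAssociativeRing

set_option linter.unusedSectionVars false

noncomputable section

namespace Contraction

/-! ### Linear algebraic groups (over an algebraically closed field) and their Lie algebras -/

section AlgebraicGroups

variable {k : Type*} [Field k] {n : Type*} [Fintype n] [DecidableEq n]

/-- The value at the matrix `A` of a polynomial in the matrix entries. -/
def evalAt (A : Matrix n n k) : MvPolynomial (n × n) k →ₐ[k] k :=
  MvPolynomial.aeval fun ij => A ij.1 ij.2

/-- The value of a polynomial in the matrix entries at the matrix `A + ε X`
over the ring of dual numbers `k[ε]`. -/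
def evalDual (A X : Matrix n n k) : MvPolynomial (n × n) k →ₐ[k] DualNumber k :=
  MvPolynomial.aeval fun ij =>
    (TrivSqZeroExt.inl (A ij.1 ij.2) + TrivSqZeroExt.inr (X ij.1 ij.2) : DualNumber k)

/-- A subset of `GL n k` is Zariski closed if it is the set of common zeros in `GL n k` of a family
of polynomials in the matrix entries. -/
def IsZariskiClosed (S : Set (GL n k)) : Prop :=
  ∃ E : Set (MvPolynomial (n × n) k), S = {g : GL n k | ∀ p ∈ E, evalAt (g : Matrix n n k) p = 0}

/-- Connectedness in the Zariski topology of `GL n k`: the set is nonempty and it is not covered by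
two Zariski closed sets that are disjoint on it, unless one of them covers it. -/
def IsZariskiConnected (S : Set (GL n k)) : Prop :=
  S.Nonempty ∧ ∀ Z W : Set (GL n k), IsZariskiClosed Z → IsZariskiClosed W →
    S ⊆ Z ∪ W → S ∩ (Z ∩ W) = ∅ → S ⊆ Z ∨ S ⊆ W

/-- The polynomials in the matrix entries that vanish on `S`. -/
def vanishing (S : Set (GL n k)) : Set (MvPolynomial (n × n) k) :=
  {p | ∀ g ∈ S, evalAt (g : Matrix n n k) p = 0}

/-- The derivation of the polynomial ring in the matrix entries given by the left-invariant vector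
field `A ↦ A * X`. -/
def leftDer (X : Matrix n n k) :
    Derivation k (MvPolynomial (n × n) k) (MvPolynomial (n × n) k) :=
  MvPolynomial.mkDerivation k fun ij => ∑ l, X l ij.2 • MvPolynomial.X (ij.1, l)

theorem evalDual_mul (A X : Matrix n n k) (p : MvPolynomial (n × n) k) :
    evalDual A (A * X) p =
      TrivSqZeroExt.inl (evalAt A p) + TrivSqZeroExt.inr (evalAt A (leftDer X p)) := by
  induction p using MvPolynomial.induction_on with
  | C a =>
    rw [← MvPolynomial.algebraMap_eq, AlgHom.commutes, AlgHom.commutes, Derivation.map_algebraMap]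
    ext <;> simp [TrivSqZeroExt.algebraMap_eq_inl]
  | add p q hp hq => rw [map_add, hp, hq]; ext <;> simp
  | mul_X p i hp =>
    rw [map_mul, hp]
    have h1 : evalDual A (A * X) (MvPolynomial.X i) =
        TrivSqZeroExt.inl (A i.1 i.2) + TrivSqZeroExt.inr ((A * X) i.1 i.2) := by
      simp [evalDual]
    have h2 : evalAt A (MvPolynomial.X i) = A i.1 i.2 := by simp [evalAt]
    have h3 : evalAt A (leftDer X (MvPolynomial.X i)) = (A * X) i.1 i.2 := by
      simp [leftDer, MvPolynomial.mkDerivation_X, Matrix.mul_apply, evalAt, mul_comm]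
    rw [h1]
    ext
    · simp [h2]
    · simp [h2, h3]; ring

theorem evalDual_one (X : Matrix n n k) (p : MvPolynomial (n × n) k) :
    evalDual 1 X p =
      TrivSqZeroExt.inl (evalAt 1 p) + TrivSqZeroExt.inr (evalAt 1 (leftDer X p)) := by
  simpa using evalDual_mul 1 X p

/-- Left and right translation of polynomials in the matrix entries. -/
def translate (L R : Matrix n n k) : MvPolynomial (n × n) k →ₐ[k] MvPolynomial (n × n) k :=
  MvPolynomial.aeval fun ij =>
    ∑ l, ∑ m, MvPolynomial.C (L ij.1 l * R m ij.2) * MvPolynomial.X (l, m)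

theorem evalAt_translate (L R A : Matrix n n k) (p : MvPolynomial (n × n) k) :
    evalAt A (translate L R p) = evalAt (L * A * R) p := by
  have : (evalAt A).comp (translate L R) = evalAt (L * A * R) := by
    ext ij
    simp only [evalAt, translate, AlgHom.comp_apply, MvPolynomial.aeval_X, map_sum, map_mul,
      MvPolynomial.aeval_C, Matrix.mul_apply, Finset.sum_mul, Algebra.algebraMap_self, RingHom.id_apply]
    rw [Finset.sum_comm]
    refine Finset.sum_congr rfl fun _ _ => Finset.sum_congr rfl fun _ _ => ?_
    ring
  exact DFunLike.congr_fun this p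

theorem evalDual_translate (L R A X : Matrix n n k) (p : MvPolynomial (n × n) k) :
    evalDual A X (translate L R p) = evalDual (L * A * R) (L * X * R) p := by
  have : (evalDual A X).comp (translate L R) = evalDual (L * A * R) (L * X * R) := by
    apply MvPolynomial.algHom_ext
    intro ij
    simp only [evalDual, translate, AlgHom.comp_apply, MvPolynomial.aeval_X, map_sum, map_mul,
      MvPolynomial.aeval_C, Matrix.mul_apply, Finset.sum_mul]
    rw [Finset.sum_comm]
    ext
    · simp only [TrivSqZeroExt.fst_sum, TrivSqZeroExt.fst_mul, TrivSqZeroExt.fst_add,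
        TrivSqZeroExt.fst_inl, TrivSqZeroExt.fst_inr, add_zero, TrivSqZeroExt.algebraMap_eq_inl]
      refine Finset.sum_congr rfl fun _ _ => Finset.sum_congr rfl fun _ _ => ?_
      ring
    · simp only [TrivSqZeroExt.snd_sum, TrivSqZeroExt.snd_add,
        TrivSqZeroExt.snd_inl, TrivSqZeroExt.snd_inr, zero_add, TrivSqZeroExt.algebraMap_eq_inl]
      refine Finset.sum_congr rfl fun _ _ => Finset.sum_congr rfl fun _ _ => ?_
      simp; ring
  exact DFunLike.congr_fun this p

theorem leftDer_mem_vanishing (H : Subgroup (GL n k)) {X : Matrix n n k}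
    (hX : ∀ p ∈ vanishing (H : Set (GL n k)), evalDual 1 X p = 0)
    {p : MvPolynomial (n × n) k} (hp : p ∈ vanishing (H : Set (GL n k))) :
    leftDer X p ∈ vanishing (H : Set (GL n k)) := by
  intro g hg
  have h1 : translate (g : Matrix n n k) 1 p ∈ vanishing (H : Set (GL n k)) := by
    intro h hh
    rw [evalAt_translate, mul_one]
    simpa using hp (g * h) (H.mul_mem hg hh)
  have h2 := hX _ h1
  rw [evalDual_translate, mul_one, mul_one, mul_one, evalDual_mul] at h2
  simpa using congrArg TrivSqZeroExt.snd h2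

theorem evalDual_one_eq_zero_iff (H : Subgroup (GL n k)) (X : Matrix n n k) :
    (∀ p ∈ vanishing (H : Set (GL n k)), evalDual 1 X p = 0) ↔
      ∀ p ∈ vanishing (H : Set (GL n k)), evalAt 1 (leftDer X p) = 0 := by
  refine forall₂_congr fun p hp => ?_
  have h1 : evalAt (1 : Matrix n n k) p = 0 := by simpa using hp 1 H.one_mem
  rw [evalDual_one, h1]
  constructor
  · intro h
    simpa using congrArg TrivSqZeroExt.snd h
  · intro h
    simp [h]

theorem leftDer_add (X Y : Matrix n n k) : leftDer (X + Y) = leftDer X + leftDer Y := by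
  apply MvPolynomial.derivation_ext
  intro i
  simp [leftDer, MvPolynomial.mkDerivation_X, add_smul, Finset.sum_add_distrib]

theorem leftDer_smul (c : k) (X : Matrix n n k) : leftDer (c • X) = c • leftDer X := by
  apply MvPolynomial.derivation_ext
  intro i
  simp [leftDer, MvPolynomial.mkDerivation_X, mul_smul, Finset.smul_sum]

theorem leftDer_lie (X Y : Matrix n n k) : leftDer ⁅X, Y⁆ = ⁅leftDer X, leftDer Y⁆ := by
  apply MvPolynomial.derivation_ext
  intro i
  have key : ∀ (U V : Matrix n n k) (i : n × n),
      leftDer U (leftDer V (MvPolynomial.X i)) =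
        ∑ m, (U * V) m i.2 • (MvPolynomial.X (i.1, m) : MvPolynomial (n × n) k) := by
    intro U V i
    have h1 : ∀ (W : Matrix n n k) (i : n × n), leftDer W (MvPolynomial.X i) =
        ∑ l, W l i.2 • (MvPolynomial.X (i.1, l) : MvPolynomial (n × n) k) := fun W i => by
      simp [leftDer, MvPolynomial.mkDerivation_X]
    simp only [h1, map_sum, Derivation.map_smul, Matrix.mul_apply, Finset.sum_smul,
      Finset.smul_sum, smul_smul]
    rw [Finset.sum_comm]
    refine Finset.sum_congr rfl fun _ _ => Finset.sum_congr rfl fun _ _ => ?_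
    rw [mul_comm]
  rw [Derivation.commutator_apply, key, key, ← Finset.sum_sub_distrib]
  simp [leftDer, MvPolynomial.mkDerivation_X, Ring.lie_def, sub_smul]

/-- The Lie algebra of a subgroup `H` of `GL n k`: all matrices `X` such that `1 + ε X` is a
`k[ε]`-valued point of the Zariski closure of `H`, i.e. the tangent space at `1`. -/
def lieAlg (H : Subgroup (GL n k)) : LieSubalgebra k (Matrix n n k) where
  carrier := {X | ∀ p ∈ vanishing (H : Set (GL n k)), evalDual 1 X p = 0}
  add_mem' {X Y} hX hY := by
    rw [Set.mem_ofPred_eq, evalDual_one_eq_zero_iff] at hX hY ⊢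
    intro p hp
    simp [leftDer_add, hX p hp, hY p hp]
  zero_mem' := by
    rw [Set.mem_ofPred_eq, evalDual_one_eq_zero_iff]
    intro p _
    have : leftDer (0 : Matrix n n k) = 0 := by
      simpa using leftDer_smul (0 : k) (0 : Matrix n n k)
    simp [this]
  smul_mem' c X hX := by
    rw [Set.mem_ofPred_eq, evalDual_one_eq_zero_iff] at hX ⊢
    intro p hp
    simp [leftDer_smul, hX p hp]
  lie_mem' {X Y} hX hY := by
    have hX' := (evalDual_one_eq_zero_iff H X).1 hX
    have hY' := (evalDual_one_eq_zero_iff H Y).1 hY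
    refine (evalDual_one_eq_zero_iff H _).2 fun p hp => ?_
    rw [leftDer_lie, Derivation.commutator_apply, map_sub,
      hX' _ (leftDer_mem_vanishing H hY hp), hY' _ (leftDer_mem_vanishing H hX hp), sub_zero]

theorem mem_lieAlg {H : Subgroup (GL n k)} {X : Matrix n n k} :
    X ∈ lieAlg H ↔ ∀ p ∈ vanishing (H : Set (GL n k)), evalDual 1 X p = 0 := Iff.rfl

theorem conj_mem_lieAlg (H : Subgroup (GL n k)) {g : GL n k} (hg : g ∈ H) {X : Matrix n n k}
    (hX : X ∈ lieAlg H) :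
    (g : Matrix n n k) * X * ((g⁻¹ : GL n k) : Matrix n n k) ∈ lieAlg H := by
  rw [mem_lieAlg] at hX ⊢
  intro p hp
  have h1 : translate (g : Matrix n n k) ((g⁻¹ : GL n k) : Matrix n n k) p ∈
      vanishing (H : Set (GL n k)) := by
    intro h hh
    rw [evalAt_translate]
    simpa using hp (g * h * g⁻¹) (H.mul_mem (H.mul_mem hg hh) (H.inv_mem hg))
  have h2 := hX _ h1
  rwa [evalDual_translate, mul_one, ← Units.val_mul, mul_inv_cancel, Units.val_one] at h2

/-- The adjoint representation `Ad` of `G` on its Lie algebra, `Ad(g) X = g X g⁻¹`. -/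
def Ad (G : Subgroup (GL n k)) : Representation k G (lieAlg G) where
  toFun g :=
    { toFun := fun X => ⟨((g : GL n k) : Matrix n n k) * X * (((g : GL n k)⁻¹ : GL n k) :
        Matrix n n k), conj_mem_lieAlg G g.2 X.2⟩
      map_add' := fun X Y => by ext1; simp [mul_add, add_mul]
      map_smul' := fun c X => by ext1; simp }
  map_one' := by ext1 X; ext1; simp
  map_mul' g h := by ext1 X; ext1; simp [mul_assoc]

theorem Ad_lie (G : Subgroup (GL n k)) (g : G) (X Y : lieAlg G) :
    Ad G g ⁅X, Y⁆ = ⁅Ad G g X, Ad G g Y⁆ := by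
  ext1
  have h : (((g : GL n k)⁻¹ : GL n k) : Matrix n n k) * ((g : GL n k) : Matrix n n k) = 1 := by
    rw [← Units.val_mul, inv_mul_cancel, Units.val_one]
  have h' : ∀ Z : Matrix n n k, (((g : GL n k)⁻¹ : GL n k) : Matrix n n k) *
      (((g : GL n k) : Matrix n n k) * Z) = Z := fun Z => by rw [← mul_assoc, h, one_mul]
  simp only [Ad, MonoidHom.coe_mk, OneHom.coe_mk, LinearMap.coe_mk, AddHom.coe_mk,
    LieSubalgebra.coe_bracket, Ring.lie_def, mul_sub, sub_mul, mul_assoc, h']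

/-! ### The contraction `𝔥 ⋉ (𝔤/𝔥)ᵃ` attached to a subgroup `H ≤ G`, and its group -/

variable (G H : Subgroup (GL n k))

/-- The Lie algebra `𝔥` of a subgroup `H` of `G`, as a subalgebra of the Lie algebra `𝔤` of `G`. -/
def subLie : LieSubalgebra k (lieAlg G) := (lieAlg H).comap (lieAlg G).incl

/-- The vector space `𝔤/𝔥`. -/
abbrev QuotSpace : Type _ := lieAlg G ⧸ (subLie G H).toSubmodule

/-- The map `𝔥 × 𝔤/𝔥 → 𝔤/𝔥`, `(b, η) ↦ b ∘ η`, induced by the Lie bracket of `𝔤`. -/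
def circ : subLie G H →ₗ[k] QuotSpace G H →ₗ[k] QuotSpace G H where
  toFun b := (subLie G H).toSubmodule.mapQ (subLie G H).toSubmodule
    (LieAlgebra.ad k (lieAlg G) (b : lieAlg G))
    (fun _ hx => (subLie G H).lie_mem b.2 hx)
  map_add' b c := by
    apply Submodule.linearMap_qext
    ext x
    simp
    rfl
  map_smul' a b := by
    apply Submodule.linearMap_qext
    ext x
    simp
    rfl

theorem circ_mk (b : subLie G H) (x : lieAlg G) :
    circ G H b (Submodule.Quotient.mk x) = Submodule.Quotient.mk ⁅(b : lieAlg G), x⁆ := rfl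

/-- The underlying vector space of `𝔮 = 𝔥 ⋉ (𝔤/𝔥)ᵃ`. -/
abbrev Contr : Type _ := subLie G H × QuotSpace G H

variable {G H} (hHG : H ≤ G)

theorem Ad_mem_subLie (s : H) {X : lieAlg G} (hX : X ∈ subLie G H) :
    Ad G (Subgroup.inclusion hHG s) X ∈ subLie G H :=
  conj_mem_lieAlg H s.2 hX

/-- The adjoint representation of `H` on `𝔥`. -/
def AdSub : Representation k H (subLie G H) where
  toFun s := (Ad G (Subgroup.inclusion hHG s)).restrict
    (p := (subLie G H).toSubmodule) (q := (subLie G H).toSubmodule)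
    fun _ hX => Ad_mem_subLie hHG s hX
  map_one' := by ext1 X; ext1; simp [LinearMap.restrict_apply]
  map_mul' s t := by ext1 X; ext1; simp [LinearMap.restrict_apply]

/-- The representation of `H` on `𝔤/𝔥` induced by the adjoint representation of `G`. -/
def AdQuot : Representation k H (QuotSpace G H) where
  toFun s := (subLie G H).toSubmodule.mapQ (subLie G H).toSubmodule
    (Ad G (Subgroup.inclusion hHG s)) fun _ hX => Ad_mem_subLie hHG s hX
  map_one' := by
    apply Submodule.linearMap_qext
    ext x
    simp
  map_mul' s t := by
    apply Submodule.linearMap_qext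
    ext x
    simp

theorem AdQuot_circ (s : H) (b : subLie G H) (v : QuotSpace G H) :
    AdQuot hHG s (circ G H b v) = circ G H (AdSub hHG s b) (AdQuot hHG s v) := by
  obtain ⟨x, rfl⟩ := Submodule.Quotient.mk_surjective _ v
  change Submodule.Quotient.mk (Ad G (Subgroup.inclusion hHG s) ⁅(b : lieAlg G), x⁆) =
    Submodule.Quotient.mk ⁅Ad G (Subgroup.inclusion hHG s) (b : lieAlg G),
      Ad G (Subgroup.inclusion hHG s) x⁆
  rw [Ad_lie]

/-- The action of `H` by automorphisms on the vector group `N = exp((𝔤/𝔥)ᵃ)`, which is the additive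
group `𝔤/𝔥` written multiplicatively. -/
def actN : H →* MulAut (Multiplicative (QuotSpace G H)) where
  toFun s :=
    { toFun := fun v => Multiplicative.ofAdd (AdQuot hHG s v.toAdd)
      invFun := fun v => Multiplicative.ofAdd (AdQuot hHG s⁻¹ v.toAdd)
      left_inv := fun v => by simp
      right_inv := fun v => by simp
      map_mul' := fun v w => by simp }
  map_one' := by ext v; simp
  map_mul' s t := by ext v; simp

/-- The group `Q = H ⋉ N`, `N = exp((𝔤/𝔥)ᵃ)`. -/
abbrev ContrGroup : Type _ := Multiplicative (QuotSpace G H) ⋊[actN hHG] H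

/-- The adjoint representation of `Q = H ⋉ N` on `𝔮`. The element `(v, s)` of the semidirect product
is `exp(v) * s`, where `s` acts by `(b, w) ↦ (Ad(s) b, s • w)` and `exp(v)` acts by
`(b, w) ↦ (b, w - b ∘ v)`. -/
def AdQ : Representation k (ContrGroup hHG) (Contr G H) where
  toFun γ :=
    { toFun := fun x => (AdSub hHG γ.right x.1,
        AdQuot hHG γ.right x.2 - circ G H (AdSub hHG γ.right x.1) γ.left.toAdd)
      map_add' := fun x y => by
        ext1
        · simp
        · simp; abel
      map_smul' := fun c x => by
        ext1
        · simp
        · simp [smul_sub] }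
  map_one' := by
    apply LinearMap.ext
    intro x
    ext1 <;> simp
  map_mul' γ δ := by
    apply LinearMap.ext
    intro x
    ext1
    · simp
    · have h : (Multiplicative.toAdd ((actN hHG γ.right) δ.left) : QuotSpace G H) =
        AdQuot hHG γ.right δ.left.toAdd := rfl
      simp [AdQuot_circ, h]; abel

/-- `Ad_Q(s exp(η)) (b, η') = (Ad(s) b, s • (η' - b ∘ η))`. -/
theorem AdQ_inr_mul_inl (s : H) (v : QuotSpace G H) (b : subLie G H) (w : QuotSpace G H) :
    AdQ hHG (SemidirectProduct.inr s * SemidirectProduct.inl (Multiplicative.ofAdd v)) (b, w) =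
      (AdSub hHG s b, AdQuot hHG s (w - circ G H b v)) := by
  rw [map_mul]
  ext1
  · simp [AdQ]
  · simp [AdQ]

end AlgebraicGroups

/-! ### Polynomial functions and invariants -/

section Invariants

variable (k : Type*) [Field k]

/-- The algebra `k[V]` of polynomial functions on a vector space `V`: the algebra of functions
generated by the linear forms. -/
def polyFun (V : Type*) [AddCommGroup V] [Module k V] : Subalgebra k (V → k) :=
  Algebra.adjoin k (Set.range fun φ : Module.Dual k V => (φ : V → k))

variable {k}

/-- The algebra `k[V]^Γ` of invariant polynomial functions of a representation of `Γ` on `V`. -/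
def invariants {Γ V : Type*} [Group Γ] [AddCommGroup V] [Module k V] (ρ : Representation k Γ V) :
    Subalgebra k (V → k) where
  carrier := {f | f ∈ polyFun k V ∧ ∀ γ x, f (ρ γ x) = f x}
  mul_mem' hf hg := ⟨mul_mem hf.1 hg.1, fun γ x => by simp [hf.2, hg.2]⟩
  add_mem' hf hg := ⟨add_mem hf.1 hg.1, fun γ x => by simp [hf.2, hg.2]⟩
  algebraMap_mem' r := ⟨Subalgebra.algebraMap_mem _ r, fun γ x => rfl⟩

end Invariants

/-! ### The nilradical of a Borel subalgebra -/

/-- The sum `𝔲` of the root spaces of the roots that are positive with respect to the base `b`. -/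
def posNilpotent {k L : Type*} [Field k] [CharZero k] [IsAlgClosed k] [LieRing L] [LieAlgebra k L]
    [FiniteDimensional k L] [LieAlgebra.HasTrivialRadical k L]
    (t : LieSubalgebra k L) [t.IsCartanSubalgebra]
    (b : (LieAlgebra.IsKilling.rootSystem t).Base) : Submodule k L :=
  ⨆ α : {α : t.root // b.IsPos α}, (LieAlgebra.rootSpace t (α.1.1 : t → k)).toSubmodule

end Contraction

end

/-!
The algebra of invariants of the contraction `𝔮 = 𝔟 ⋉ (𝔤/𝔟)ᵃ` is `k[𝔱]`, for two reasons.

*The functions `p ∘ π` are invariant.* This says that `Ad(s) b - b ∈ 𝔲` for `s ∈ B` and `b ∈ 𝔟`.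
As `[𝔟, 𝔟] ⊆ 𝔲` (`lie_mem_posNilpotent`), it follows from the fact that a connected group acts
trivially on the abelianization of its Lie algebra in characteristic `0` (`conj_sub_mem`). There, a
linear form on `Ad(s) b - b` which kills the derived algebra gives, after multiplication by a power
of `det s`, a polynomial `f` with `f(1) = 0` which is an eigenfunction of all left-invariant vector
fields of `B`. Such an `f` vanishes on `B` (`evalAt_eq_zero_of_eigen`): a combination `E` of the
left-invariant vector fields, with coefficients vanishing at `1`, acts as the identity on the
cotangent space at `1`, hence as `r` on the part of degree `r` of the associated graded ring of the
local ring at `1`; since `E f` is a multiple of `f` by a function vanishing at `1`, this puts `f` into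
all powers of the maximal ideal, and Krull's intersection theorem shows that `f` is zero near `1`.
After translation, the zero set of `f` is open and closed in `B`. Smoothness of `B` is not used.

*There are no other invariants.* Fix `τ ∈ 𝔱` on which no root vanishes. Then `ad τ` is surjective on
`𝔲` and on `𝔤/𝔟`, and therefore so is `ad (b + c τ)`, for every `b ∈ 𝔟` and all but finitely many
`c ∈ k`. For such elements in place of `b`, invariance under `exp((𝔤/𝔟)ᵃ)` gives `f(b, w) = f(b, 0)`,
and the differential of `f(·, 0)` at `b`, which vanishes on `[𝔟, b]` by invariance under `B`, vanishes
on `𝔲`. Both are polynomial identities, so they hold at `c = 0` too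
(`invariants_apply_eq_zero_right`, `evalAt_dirDer_eq_zero`), and `f(b, w)` depends only on the class
of `b` in `𝔟/𝔲 = 𝔱` (`invariants_apply_eq`).
-/

noncomputable section

namespace Contraction

universe u

/-! ### Eigenfunctions of the invariant vector fields on a connected group -/

theorem mul_mem_pow_sup {R : Type*} [CommRing R] {M I : Ideal R} {i j : ℕ} {a b : R}
    (ha : a ∈ M ^ i) (hb : b ∈ M ^ j ⊔ I) : a * b ∈ M ^ (i + j) ⊔ I := by
  obtain ⟨y, hy, z, hz, rfl⟩ := Submodule.mem_sup.1 hb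
  rw [mul_add, pow_add]
  exact Submodule.add_mem_sup (Ideal.mul_mem_mul ha hy) (I.mul_mem_left a hz)

/-- If a derivation `E` acts as the identity on the cotangent space `M / (M ^ 2 + I)`, then it acts
as multiplication by `r + 1` on the part of degree `r + 1` of the associated graded ring
of `R ⧸ I`. -/
theorem euler_mem_pow {k R : Type*} [Field k] [CommRing R] [Algebra k R] (E : Derivation k R R)
    {M I : Ideal R} (hI : ∀ x ∈ I, E x ∈ I) (hM : ∀ x ∈ M, E x - x ∈ M ^ 2 ⊔ I) (r : ℕ) {x : R}
    (hx : x ∈ M ^ (r + 1) ⊔ I) : E x - ((r + 1 : ℕ) : R) * x ∈ M ^ (r + 2) ⊔ I := by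
  have red : ∀ s : ℕ, (∀ x ∈ M ^ (s + 1), E x - ((s + 1 : ℕ) : R) * x ∈ M ^ (s + 2) ⊔ I) →
      ∀ x ∈ M ^ (s + 1) ⊔ I, E x - ((s + 1 : ℕ) : R) * x ∈ M ^ (s + 2) ⊔ I := by
    intro s hs x hx
    obtain ⟨y, hy, z, hz, rfl⟩ := Submodule.mem_sup.1 hx
    have h1 : E z - ((s + 1 : ℕ) : R) * z ∈ M ^ (s + 2) ⊔ I :=
      Ideal.mem_sup_right (I.sub_mem (hI z hz) (I.mul_mem_left _ hz))
    have h2 := Ideal.add_mem _ (hs y hy) h1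
    rw [map_add]
    convert h2 using 1
    ring
  refine red r ?_ x hx
  clear hx x
  induction r with
  | zero => intro x hx; simpa using hM x (by simpa using hx)
  | succ r ih =>
    intro x hx
    rw [pow_succ] at hx
    refine Submodule.mul_induction_on hx (fun a ha b hb => ?_) (fun a b ha hb => ?_)
    · have h1 : a * (E b - b) ∈ M ^ (r + 3) ⊔ I := by
        rw [show r + 3 = r + 1 + 2 by ring]
        exact mul_mem_pow_sup ha (hM b hb)
      have h2 : b * (E a - ((r + 1 : ℕ) : R) * a) ∈ M ^ (r + 3) ⊔ I := by
        rw [add_comm r 3, show 3 + r = 1 + (r + 2) by ring]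
        exact mul_mem_pow_sup (by rwa [pow_one]) (ih a ha)
      have h3 := Ideal.add_mem _ h1 h2
      rw [Derivation.leibniz, smul_eq_mul, smul_eq_mul]
      convert h3 using 1
      push_cast
      ring
    · rw [map_add]
      convert Ideal.add_mem _ ha hb using 1
      ring

/-- An element `f ∈ M` with `E f ∈ M f + I`, for a derivation `E` as in `euler_mem_pow`, lies in
all powers of `M` modulo `I`: if `f ∈ M ^ (r + 1)` then `(r + 1) f ≡ E f` modulo `M ^ (r + 2)`, and
`E f` lies in `M ^ (r + 2)` as well. -/
theorem mem_pow_of_euler {k R : Type*} [Field k] [CharZero k] [CommRing R] [Algebra k R]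
    (E : Derivation k R R) {M I : Ideal R} (hI : ∀ x ∈ I, E x ∈ I)
    (hM : ∀ x ∈ M, E x - x ∈ M ^ 2 ⊔ I) {f y : R} (hf : f ∈ M) (hy : y ∈ M)
    (hfy : E f - y * f ∈ I) (r : ℕ) : f ∈ M ^ (r + 1) ⊔ I := by
  induction r with
  | zero => simpa using Ideal.mem_sup_left (by simpa using hf)
  | succ r ih =>
    have h1 := euler_mem_pow E hI hM r ih
    have h2 : y * f ∈ M ^ (r + 2) ⊔ I := by
      rw [show r + 2 = 1 + (r + 1) by ring]
      exact mul_mem_pow_sup (by rwa [pow_one]) ih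
    have h3 : ((r + 1 : ℕ) : R) * f ∈ M ^ (r + 2) ⊔ I := by
      have h := Ideal.sub_mem _ (Ideal.add_mem _ h2 (Ideal.mem_sup_right hfy)) h1
      convert h using 1
      ring
    have h4 := Ideal.mul_mem_left _ (algebraMap k R (((r + 1 : ℕ) : k)⁻¹)) h3
    rwa [← mul_assoc, ← map_natCast (algebraMap k R), ← map_mul,
      inv_mul_cancel₀ (Nat.cast_ne_zero.2 r.succ_ne_zero), map_one, one_mul] at h4

/-- Krull's intersection theorem for `R ⧸ I`. -/
theorem exists_mul_mem_of_forall_mem_pow {R : Type*} [CommRing R] [IsNoetherianRing R]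
    {M I : Ideal R} {f : R} (hf : ∀ r, f ∈ M ^ r ⊔ I) : ∃ m ∈ M, (1 - m) * f ∈ I := by
  have h : (Submodule.Quotient.mk f : R ⧸ I) ∈ (⨅ i : ℕ, M ^ i • (⊤ : Submodule R (R ⧸ I))) := by
    rw [Submodule.mem_iInf]
    intro i
    obtain ⟨y, hy, z, hz, rfl⟩ := Submodule.mem_sup.1 (hf i)
    have h1 : (Submodule.Quotient.mk (y + z) : R ⧸ I) = y • Submodule.Quotient.mk 1 := by
      rw [← Submodule.Quotient.mk_smul, Submodule.Quotient.eq]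
      simpa using hz
    rw [h1]
    exact Submodule.smul_mem_smul hy trivial
  obtain ⟨⟨m, hm⟩, h⟩ := (Ideal.mem_iInf_smul_pow_eq_bot_iff M _).1 h
  refine ⟨m, hm, ?_⟩
  have h' : (Submodule.Quotient.mk (m * f) : R ⧸ I) = Submodule.Quotient.mk f := h
  rw [Submodule.Quotient.eq] at h'
  convert I.neg_mem h' using 1
  ring

section

variable {k : Type*} [Field k] {n : Type*} [Fintype n] [DecidableEq n]

/-- The ideal of the polynomials in the matrix entries that vanish on `S`. -/
def vanishingIdeal (S : Set (GL n k)) : Ideal (MvPolynomial (n × n) k) where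
  carrier := vanishing S
  add_mem' hp hq g hg := by rw [map_add, hp g hg, hq g hg, add_zero]
  zero_mem' g _ := map_zero _
  smul_mem' c p hp g hg := by rw [smul_eq_mul, map_mul, hp g hg, mul_zero]

theorem mem_vanishingIdeal {S : Set (GL n k)} {p : MvPolynomial (n × n) k} :
    p ∈ vanishingIdeal S ↔ ∀ g ∈ S, evalAt (g : Matrix n n k) p = 0 := Iff.rfl

/-- The maximal ideal of the polynomials in the matrix entries that vanish at `1`. -/
def idealOne (k n : Type*) [Field k] [Fintype n] [DecidableEq n] :
    Ideal (MvPolynomial (n × n) k) :=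
  RingHom.ker (evalAt (1 : Matrix n n k))

theorem mem_idealOne {p : MvPolynomial (n × n) k} :
    p ∈ idealOne k n ↔ evalAt (1 : Matrix n n k) p = 0 := Iff.rfl

/-- The differential at `1` of a polynomial in the matrix entries, a linear form on the space of
matrices. -/
def diffOne : MvPolynomial (n × n) k →ₗ[k] Module.Dual k (Matrix n n k) where
  toFun p :=
    { toFun := fun X => evalAt 1 (leftDer X p)
      map_add' := fun X Y => by simp [leftDer_add]
      map_smul' := fun c X => by simp [leftDer_smul] }
  map_add' p q := by ext; simp
  map_smul' c p := by ext; simp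

theorem diffOne_apply (p : MvPolynomial (n × n) k) (X : Matrix n n k) :
    diffOne p X = evalAt 1 (leftDer X p) := rfl

theorem diffOne_mul (p q : MvPolynomial (n × n) k) :
    diffOne (p * q) = evalAt 1 p • diffOne q + evalAt 1 q • diffOne p := by
  ext1 X
  simp [diffOne_apply]

theorem diffOne_C (c : k) : diffOne (MvPolynomial.C c : MvPolynomial (n × n) k) = 0 := by
  ext1 X
  rw [diffOne_apply, ← MvPolynomial.algebraMap_eq, Derivation.map_algebraMap]
  simp

/-- The coordinate function `A ↦ A i j - δ i j`, which vanishes at `1`. -/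
def coordOne (i j : n) : MvPolynomial (n × n) k :=
  MvPolynomial.X (i, j) - MvPolynomial.C ((1 : Matrix n n k) i j)

theorem coordOne_mem (i j : n) : coordOne i j ∈ idealOne k n := by
  simp [mem_idealOne, coordOne, evalAt]

theorem diffOne_X (ij : n × n) (X : Matrix n n k) :
    diffOne (MvPolynomial.X ij) X = X ij.1 ij.2 := by
  simp [diffOne_apply, leftDer, MvPolynomial.mkDerivation_X, evalAt, Matrix.one_apply]

theorem diffOne_coordOne (i j : n) (X : Matrix n n k) : diffOne (coordOne i j) X = X i j := by
  rw [coordOne, map_sub, diffOne_C, sub_zero, diffOne_X]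

/-- Taylor expansion at `1` to first order. -/
theorem sub_linear_part_mem (p : MvPolynomial (n × n) k) :
    p - MvPolynomial.C (evalAt 1 p) -
      ∑ i, ∑ j, MvPolynomial.C (diffOne p (Matrix.single i j 1)) * coordOne i j ∈
        idealOne k n ^ 2 := by
  induction p using MvPolynomial.induction_on with
  | C c =>
    have : evalAt (1 : Matrix n n k) (MvPolynomial.C c) = c := by simp [evalAt]
    simp [this, diffOne_C]
  | add p q hp hq =>
    convert Ideal.add_mem _ hp hq using 1
    simp only [map_add, LinearMap.add_apply, add_mul, Finset.sum_add_distrib]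
    ring
  | mul_X p ab hp =>
    obtain ⟨a, b⟩ := ab
    have h0 : p - MvPolynomial.C (evalAt 1 p) ∈ idealOne k n := by
      simp [mem_idealOne, evalAt]
    have h1 := Ideal.mul_mem_mul h0 (coordOne_mem a b)
    rw [← pow_two] at h1
    have h2 := Ideal.add_mem _ h1
      (Ideal.mul_mem_left _ (MvPolynomial.C ((1 : Matrix n n k) a b)) hp)
    have hX : evalAt (1 : Matrix n n k) (MvPolynomial.X (a, b)) = (1 : Matrix n n k) a b := by
      simp [evalAt]
    have h3 : ∑ i, ∑ j, MvPolynomial.C ((Matrix.single i j (1 : k)) a b) *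
        coordOne i j = coordOne a b := by
      rw [Finset.sum_eq_single a, Finset.sum_eq_single b]
      · simp
      · intro j _ hj; simp [hj]
      · simp
      · intro i _ hi; simp [hi]
      · simp
    convert h2 using 1
    simp only [diffOne_mul, LinearMap.add_apply, LinearMap.smul_apply, smul_eq_mul, diffOne_X,
      map_add, add_mul, Finset.sum_add_distrib, map_mul, hX, mul_assoc, ← Finset.mul_sum, h3]
    simp only [coordOne]
    ring

/-- A polynomial vanishing to first order at `1` lies in the square of the maximal ideal. -/
theorem mem_idealOne_sq {p : MvPolynomial (n × n) k} (hp : p ∈ idealOne k n)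
    (hd : diffOne p = 0) : p ∈ idealOne k n ^ 2 := by
  have h := sub_linear_part_mem p
  rw [mem_idealOne] at hp
  simpa [hp, hd] using h

/-- The cotangent space of a subgroup at `1`: a polynomial whose differential vanishes on the Lie
algebra agrees, modulo the square of the maximal ideal, with one vanishing on the subgroup. -/
theorem mem_sq_sup_vanishingIdeal (H : Subgroup (GL n k)) {p : MvPolynomial (n × n) k}
    (hp : p ∈ idealOne k n) (hd : ∀ X ∈ lieAlg H, diffOne p X = 0) :
    p ∈ idealOne k n ^ 2 ⊔ vanishingIdeal (H : Set (GL n k)) := by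
  have hI : vanishingIdeal (H : Set (GL n k)) ≤ idealOne k n := fun q hq =>
    mem_idealOne.2 (by simpa using hq 1 H.one_mem)
  -- The Lie algebra is the common kernel of the differentials of the polynomials vanishing on `H`,
  -- so a linear form that kills it is one of these differentials.
  let Φ : Subspace k (Module.Dual k (Matrix n n k)) :=
    ((vanishingIdeal (H : Set (GL n k))).restrictScalars k).map diffOne
  have h1 : diffOne p ∈ Φ := by
    rw [← Subspace.dualCoannihilator_dualAnnihilator_eq (W := Φ), Submodule.mem_dualAnnihilator]
    intro X hX
    refine hd X ?_
    rw [mem_lieAlg, evalDual_one_eq_zero_iff]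
    intro q hq
    exact (Submodule.mem_dualCoannihilator _).1 hX _ ⟨q, hq, rfl⟩
  obtain ⟨q, hq, hqp⟩ := h1
  have h2 : p - q ∈ idealOne k n ^ 2 :=
    mem_idealOne_sq (Ideal.sub_mem _ hp (hI hq)) (by rw [map_sub, hqp, sub_self])
  have h3 := Ideal.add_mem _ (Ideal.mem_sup_left h2) (Ideal.mem_sup_right hq)
  rwa [sub_add_cancel] at h3

/-- A polynomial which vanishes at `1` and, on `H`, is an eigenfunction of all left-invariant
vector fields of `H`, vanishes on a neighbourhood of `1` in `H`. -/
theorem exists_mul_mem_vanishingIdeal [CharZero k] (H : Subgroup (GL n k))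
    {f : MvPolynomial (n × n) k} (hf : evalAt (1 : Matrix n n k) f = 0)
    (hχ : ∀ X ∈ lieAlg H, ∃ c : k, ∀ g ∈ H, evalAt (g : Matrix n n k) (leftDer X f) =
      c * evalAt (g : Matrix n n k) f) :
    ∃ h : MvPolynomial (n × n) k, evalAt (1 : Matrix n n k) h = 1 ∧
      ∀ g ∈ H, evalAt (g : Matrix n n k) (h * f) = 0 := by
  obtain ⟨P, hP⟩ := (lieAlg H).toSubmodule.subtype.exists_leftInverse_of_injective
    (Submodule.ker_subtype _)
  have hPX : ∀ X ∈ lieAlg H, (P X : Matrix n n k) = X := fun X hX =>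
    congrArg Subtype.val (DFunLike.congr_fun hP ⟨X, hX⟩)
  -- `P` is a projection onto the Lie algebra. If it is written as `∑ φₐ ⊗ Xₐ`, then `E` is
  -- the sum of the `yₐ * leftDer Xₐ`, where `yₐ` vanishes at `1` and has differential `φₐ` there.
  let E : Derivation k (MvPolynomial (n × n) k) (MvPolynomial (n × n) k) :=
    ∑ i, ∑ j, (coordOne i j : MvPolynomial (n × n) k) •
      leftDer (P (Matrix.single i j 1) : Matrix n n k)
  have hE : ∀ p, E p = ∑ i, ∑ j, coordOne i j *
      leftDer (P (Matrix.single i j 1) : Matrix n n k) p := by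
    intro p
    have h := congrFun (map_sum (Derivation.coeFnAddMonoidHom (R := k)
      (A := MvPolynomial (n × n) k) (M := MvPolynomial (n × n) k)) (fun i => ∑ j,
        (coordOne i j : MvPolynomial (n × n) k) •
          leftDer (P (Matrix.single i j 1) : Matrix n n k)) Finset.univ) p
    refine h.trans ?_
    rw [Finset.sum_apply]
    refine Finset.sum_congr rfl fun i _ => ?_
    have h' := congrFun (map_sum (Derivation.coeFnAddMonoidHom (R := k)
      (A := MvPolynomial (n × n) k) (M := MvPolynomial (n × n) k)) (fun j =>
        (coordOne i j : MvPolynomial (n × n) k) •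
          leftDer (P (Matrix.single i j 1) : Matrix n n k)) Finset.univ) p
    refine h'.trans ?_
    rw [Finset.sum_apply]
    rfl
  have hI : ∀ x ∈ vanishingIdeal (H : Set (GL n k)), E x ∈ vanishingIdeal (H : Set (GL n k)) := by
    intro x hx
    rw [hE]
    exact Ideal.sum_mem _ fun i _ => Ideal.sum_mem _ fun j _ => Ideal.mul_mem_left _ _
      (leftDer_mem_vanishing H (P (Matrix.single i j 1)).2 hx)
  have hdE : ∀ p X, diffOne (E p) X = diffOne p (P X) := by
    intro p X
    have hX : X = ∑ i, ∑ j, X i j • Matrix.single i j (1 : k) := by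
      conv_lhs => rw [Matrix.matrix_eq_sum_single X]
      simp
    conv_rhs => rw [hX]
    simp only [hE, map_sum, LinearMap.sum_apply, map_smul, Submodule.coe_sum, Submodule.coe_smul]
    refine Finset.sum_congr rfl fun i _ => Finset.sum_congr rfl fun j _ => ?_
    rw [diffOne_mul, mem_idealOne.1 (coordOne_mem i j), zero_smul, zero_add, LinearMap.smul_apply,
      diffOne_coordOne, ← diffOne_apply, smul_eq_mul, smul_eq_mul, mul_comm]
  have hM : ∀ x ∈ idealOne k n, E x - x ∈ idealOne k n ^ 2 ⊔ vanishingIdeal (H : Set (GL n k)) := by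
    intro x hx
    refine mem_sq_sup_vanishingIdeal H (Ideal.sub_mem _ ?_ hx) fun X hX => ?_
    · rw [hE]
      exact Ideal.sum_mem _ fun i _ => Ideal.sum_mem _ fun j _ =>
        Ideal.mul_mem_right _ _ (coordOne_mem i j)
    · rw [map_sub, LinearMap.sub_apply, hdE, hPX X hX, sub_self]
  choose c hc using fun i j => hχ _ (P (Matrix.single i j 1)).2
  have hy : ∑ i, ∑ j, coordOne i j * MvPolynomial.C (c i j) ∈ idealOne k n :=
    Ideal.sum_mem _ fun i _ => Ideal.sum_mem _ fun j _ => Ideal.mul_mem_right _ _ (coordOne_mem i j)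
  have hfy : E f - (∑ i, ∑ j, coordOne i j * MvPolynomial.C (c i j)) * f ∈
      vanishingIdeal (H : Set (GL n k)) := by
    intro g hg
    have hC : ∀ a : k, evalAt (g : Matrix n n k) (MvPolynomial.C a) = a := fun a => by simp [evalAt]
    simp only [hE, map_sub, map_sum, map_mul, hc _ _ g hg, hC, Finset.sum_mul, mul_assoc, sub_self]
  have hpow := mem_pow_of_euler E hI hM hf hy hfy
  obtain ⟨m, hm, h⟩ := exists_mul_mem_of_forall_mem_pow (M := idealOne k n)
    (I := vanishingIdeal (H : Set (GL n k))) (f := f) fun r =>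
      (sup_le_sup (Ideal.pow_le_pow_right r.le_succ) le_rfl :
        _ ≤ idealOne k n ^ r ⊔ vanishingIdeal (H : Set (GL n k))) (hpow r)
  exact ⟨1 - m, by rw [map_sub, map_one, mem_idealOne.1 hm, sub_zero], h⟩

theorem evalAt_leftDer_translate (L A X : Matrix n n k) (p : MvPolynomial (n × n) k) :
    evalAt A (leftDer X (translate L 1 p)) = evalAt (L * A) (leftDer X p) := by
  have h := evalDual_mul A X (translate L 1 p)
  rw [evalDual_translate, mul_one, mul_one, ← mul_assoc, evalDual_mul] at h
  simpa using (congrArg TrivSqZeroExt.snd h).symm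

/-- On a connected group in characteristic `0`, a polynomial that is an eigenfunction of
all left-invariant vector fields and vanishes at `1` is zero. -/
theorem evalAt_eq_zero_of_eigen [CharZero k] {H : Subgroup (GL n k)}
    (hH : IsZariskiConnected (H : Set (GL n k))) {f : MvPolynomial (n × n) k}
    (hf : evalAt (1 : Matrix n n k) f = 0)
    (hχ : ∀ X ∈ lieAlg H, ∃ c : k, ∀ g ∈ H, evalAt (g : Matrix n n k) (leftDer X f) =
      c * evalAt (g : Matrix n n k) f) {g : GL n k} (hg : g ∈ H) :
    evalAt (g : Matrix n n k) f = 0 := by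
  -- The zero set of `f` on `H` is open: near `g` it is described by the translate of `f` by `g`.
  have key : ∀ g ∈ H, evalAt (g : Matrix n n k) f = 0 → ∃ h : MvPolynomial (n × n) k,
      evalAt (g : Matrix n n k) h = 1 ∧ ∀ g' ∈ H, evalAt (g' : Matrix n n k) (h * f) = 0 := by
    intro g hg hfg
    obtain ⟨h, h1, h2⟩ := exists_mul_mem_vanishingIdeal H
      (f := translate (g : Matrix n n k) 1 f) (by rw [evalAt_translate]; simpa using hfg)
      (fun X hX => by
        obtain ⟨c, hc⟩ := hχ X hX
        refine ⟨c, fun g' hg' => ?_⟩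
        rw [evalAt_leftDer_translate, evalAt_translate, mul_one]
        exact hc (g * g') (H.mul_mem hg hg'))
    refine ⟨translate ((g⁻¹ : GL n k) : Matrix n n k) 1 h, ?_, fun g' hg' => ?_⟩
    · rw [evalAt_translate, mul_one, ← Units.val_mul, inv_mul_cancel]
      exact h1
    · have h3 := h2 (g⁻¹ * g') (H.mul_mem (H.inv_mem hg) hg')
      rw [map_mul, evalAt_translate, mul_one, ← Units.val_mul, mul_inv_cancel_left] at h3
      rw [map_mul, evalAt_translate, mul_one, ← Units.val_mul, h3]
  -- `Z` is the zero set of `f`, and `W` that of the annihilator of `f` on `H`, which contains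
  -- the points of `H` outside `Z`, and no point of `Z ∩ H` since `f` vanishes near such a point.
  let Z : Set (GL n k) := {g | ∀ p ∈ ({f} : Set (MvPolynomial (n × n) k)),
    evalAt (g : Matrix n n k) p = 0}
  let W : Set (GL n k) := {g | ∀ p ∈ {h : MvPolynomial (n × n) k |
    ∀ g' ∈ H, evalAt (g' : Matrix n n k) (h * f) = 0}, evalAt (g : Matrix n n k) p = 0}
  have h1 : (H : Set (GL n k)) ⊆ Z ∪ W := by
    intro g hg
    by_cases hfg : evalAt (g : Matrix n n k) f = 0
    · exact Or.inl (by rintro p rfl; exact hfg)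
    · refine Or.inr fun h hh => ?_
      have := hh g hg
      rw [map_mul] at this
      exact (mul_eq_zero.1 this).resolve_right hfg
  have h2 : (H : Set (GL n k)) ∩ (Z ∩ W) = ∅ := by
    rw [Set.eq_empty_iff_forall_notMem]
    rintro g ⟨hg, hgZ, hgW⟩
    obtain ⟨h, h3, h4⟩ := key g hg (hgZ f rfl)
    exact one_ne_zero (h3.symm.trans (hgW h h4))
  rcases hH.2 Z W ⟨_, rfl⟩ ⟨_, rfl⟩ h1 h2 with h | h
  · exact h hg f rfl
  · obtain ⟨p, h3, h4⟩ := key 1 H.one_mem (by simpa using hf)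
    exact absurd (h3.symm.trans (h H.one_mem p h4)) one_ne_zero

/-! ### Conjugation and the adjoint representation -/

/-- The matrix `A + ε X` over the dual numbers. -/
def dualMatrix (A X : Matrix n n k) : Matrix n n (DualNumber k) :=
  Matrix.of fun i j => TrivSqZeroExt.inl (A i j) + TrivSqZeroExt.inr (X i j)

theorem dualMatrix_mul (A X A' X' : Matrix n n k) :
    dualMatrix A X * dualMatrix A' X' = dualMatrix (A * A') (A * X' + X * A') := by
  ext i j
  · simp [dualMatrix, Matrix.mul_apply, TrivSqZeroExt.fst_sum]
  · simp [dualMatrix, Matrix.mul_apply, TrivSqZeroExt.snd_sum, Finset.sum_add_distrib, mul_comm]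

theorem dualMatrix_one : dualMatrix (1 : Matrix n n k) 0 = 1 := by
  ext i j <;> by_cases h : i = j <;> simp [dualMatrix, Matrix.one_apply, h]

/-- For a polynomial `q` in the matrix entries, `q (s b s⁻¹)` becomes polynomial in the entries
of `s` after multiplication by a power of `det s`, over all commutative algebras. -/
theorem exists_conj_polynomial {k : Type u} [Field k] (b : Matrix n n k)
    (q : MvPolynomial (n × n) k) : ∃ (N : ℕ) (P : MvPolynomial (n × n) k),
      ∀ (S : Type u) [CommRing S] [Algebra k S] (s s' : Matrix n n S), s * s' = 1 →
        MvPolynomial.aeval (fun ij => s ij.1 ij.2) P = s.det ^ N *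
          MvPolynomial.aeval (fun ij => (s * b.map (algebraMap k S) * s') ij.1 ij.2) q := by
  induction q using MvPolynomial.induction_on with
  | C c => exact ⟨0, MvPolynomial.C c, fun S _ _ s s' _ => by simp⟩
  | add p q hp hq =>
    obtain ⟨N, P, hP⟩ := hp
    obtain ⟨M, Q, hQ⟩ := hq
    let d : MvPolynomial (n × n) k := (Matrix.of fun i j => MvPolynomial.X (i, j)).det
    have hd : ∀ (S : Type u) [CommRing S] [Algebra k S] (s : Matrix n n S),
        MvPolynomial.aeval (fun ij => s ij.1 ij.2) d = s.det := by
      intro S _ _ s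
      rw [AlgHom.map_det]
      congr 1
      ext i j
      simp
    refine ⟨N + M, d ^ M * P + d ^ N * Q, fun S _ _ s s' h => ?_⟩
    simp only [map_add, map_mul, map_pow, hd, hP S s s' h, hQ S s s' h]
    ring
  | mul_X p ij hp =>
    obtain ⟨N, P, hP⟩ := hp
    let g : Matrix n n (MvPolynomial (n × n) k) := Matrix.of fun i j => MvPolynomial.X (i, j)
    refine ⟨N + 1, P * (g * b.map (algebraMap k (MvPolynomial (n × n) k)) * g.adjugate) ij.1 ij.2,
      fun S _ _ s s' h => ?_⟩
    have hg : (MvPolynomial.aeval (fun ij => s ij.1 ij.2) : MvPolynomial (n × n) k →ₐ[k] S).mapMatrix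
        g = s := by
      ext i j
      simp [g]
    have hadj : s.adjugate = s.det • s' := by
      rw [← mul_one s.adjugate, ← h, ← mul_assoc, Matrix.adjugate_mul, Matrix.smul_mul, one_mul]
    have h1 : MvPolynomial.aeval (fun ij => s ij.1 ij.2)
        ((g * b.map (algebraMap k (MvPolynomial (n × n) k)) * g.adjugate) ij.1 ij.2) =
          s.det * (s * b.map (algebraMap k S) * s') ij.1 ij.2 := by
      have h2 : (MvPolynomial.aeval (fun ij => s ij.1 ij.2) : MvPolynomial (n × n) k →ₐ[k] S).mapMatrix
          (g * b.map (algebraMap k (MvPolynomial (n × n) k)) * g.adjugate) =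
            s.det • (s * b.map (algebraMap k S) * s') := by
        rw [map_mul, map_mul, AlgHom.map_adjugate, hg, hadj, Matrix.mul_smul]
        congr 3
        ext i j
        simp
      exact congrFun (congrFun h2 ij.1) ij.2
    rw [map_mul, map_mul, hP S s s' h, h1, MvPolynomial.aeval_X]
    ring

theorem map_algebraMap_eq_dualMatrix (b : Matrix n n k) :
    b.map (algebraMap k (DualNumber k)) = dualMatrix b 0 := by
  ext i j <;> simp [dualMatrix, TrivSqZeroExt.algebraMap_eq_inl]

/-- The infinitesimal form of invariance under conjugation. -/
theorem evalDual_lie_of_invariant (H : Subgroup (GL n k)) {b : Matrix n n k}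
    {q : MvPolynomial (n × n) k}
    (hq : ∀ s ∈ H, evalAt ((s : Matrix n n k) * b * ((s⁻¹ : GL n k) : Matrix n n k)) q = evalAt b q)
    {X : Matrix n n k} (hX : X ∈ lieAlg H) :
    evalDual b ⁅X, b⁆ q = TrivSqZeroExt.inl (evalAt b q) := by
  obtain ⟨N, P, hP⟩ := exists_conj_polynomial b (q - MvPolynomial.C (evalAt b q))
  have h1 : P ∈ vanishing (H : Set (GL n k)) := by
    intro s hs
    have h := hP k (s : Matrix n n k) ((s⁻¹ : GL n k) : Matrix n n k) (by
      rw [← Units.val_mul, mul_inv_cancel, Units.val_one])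
    have h2 := hq s hs
    refine h.trans ?_
    rw [map_sub, MvPolynomial.aeval_C]
    exact mul_eq_zero_of_right _ (sub_eq_zero.2 h2)
  have hmul : dualMatrix 1 X * dualMatrix 1 (-X) = 1 := by
    rw [dualMatrix_mul, ← dualMatrix_one]
    simp
  have h2 := hP _ _ _ hmul
  have h3 : MvPolynomial.aeval (fun ij => dualMatrix 1 X ij.1 ij.2) P = 0 := hX P h1
  have hdet : IsUnit (dualMatrix 1 X).det := Matrix.isUnit_det_of_right_inverse hmul
  rw [h3, map_algebraMap_eq_dualMatrix, dualMatrix_mul, dualMatrix_mul] at h2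
  have h4 := (hdet.pow N).mul_right_eq_zero.1 h2.symm
  rw [map_sub, MvPolynomial.aeval_C, sub_eq_zero] at h4
  rw [TrivSqZeroExt.algebraMap_eq_inl] at h4
  convert h4 using 1
  simp [evalDual, dualMatrix, Ring.lie_def, sub_eq_neg_add]

/-- A connected group acts trivially on the abelianization of its Lie algebra in characteristic
`0`. For a linear form `l` killing the derived algebra, `s ↦ l (s b s⁻¹ - b)`, multiplied by a power
of `det s`, is polynomial and an eigenfunction of the left-invariant vector fields. -/
theorem conj_sub_mem [CharZero k] {H : Subgroup (GL n k)}
    (hH : IsZariskiConnected (H : Set (GL n k))) (D : Submodule k (Matrix n n k))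
    (hD : ∀ X ∈ lieAlg H, ∀ Y ∈ lieAlg H, ⁅X, Y⁆ ∈ D) {b : Matrix n n k} (hb : b ∈ lieAlg H)
    {s : GL n k} (hs : s ∈ H) :
    (s : Matrix n n k) * b * ((s⁻¹ : GL n k) : Matrix n n k) - b ∈ D := by
  rw [← Subspace.forall_mem_dualAnnihilator_apply_eq_zero_iff]
  intro l hl
  rw [Submodule.mem_dualAnnihilator] at hl
  let q : MvPolynomial (n × n) k :=
    ∑ i, ∑ j, MvPolynomial.C (l (Matrix.single i j 1)) * MvPolynomial.X (i, j) -
      MvPolynomial.C (l b)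
  have hl' : ∀ A : Matrix n n k, l A = ∑ i, ∑ j, l (Matrix.single i j 1) * A i j := by
    intro A
    conv_lhs => rw [Matrix.matrix_eq_sum_single A]
    simp only [map_sum]
    refine Finset.sum_congr rfl fun i _ => Finset.sum_congr rfl fun j _ => ?_
    rw [← mul_one (A i j), ← smul_eq_mul, ← Matrix.smul_single, map_smul, smul_eq_mul, smul_eq_mul,
      mul_one, mul_comm]
  have hq : ∀ A : Matrix n n k, evalAt A q = l A - l b := by
    intro A
    rw [hl' A]
    simp [q, evalAt]
  have hqd : ∀ A X : Matrix n n k, l X = 0 →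
      evalDual A X q = TrivSqZeroExt.inl (evalAt A q) := by
    intro A X hX
    rw [hl' X] at hX
    rw [hq, hl' A]
    ext
    · simp [q, evalDual, TrivSqZeroExt.fst_sum, TrivSqZeroExt.algebraMap_eq_inl]
    · simp [q, evalDual, TrivSqZeroExt.snd_sum, TrivSqZeroExt.algebraMap_eq_inl, hX]
  obtain ⟨N, P, hP⟩ := exists_conj_polynomial b q
  have hPk : ∀ g : GL n k, evalAt (g : Matrix n n k) P = (g : Matrix n n k).det ^ N *
      (l ((g : Matrix n n k) * b * ((g⁻¹ : GL n k) : Matrix n n k)) - l b) := by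
    intro g
    rw [← hq]
    exact hP k (g : Matrix n n k) ((g⁻¹ : GL n k) : Matrix n n k) (by
      rw [← Units.val_mul, mul_inv_cancel, Units.val_one])
  have hP1 : evalAt (1 : Matrix n n k) P = 0 := by
    have := hPk 1
    simpa using this
  have hχ : ∀ X ∈ lieAlg H, ∃ c : k, ∀ g ∈ H, evalAt (g : Matrix n n k) (leftDer X P) =
      c * evalAt (g : Matrix n n k) P := by
    intro X hX
    -- Conjugating `b` by `g (1 + ε X)` changes it by a commutator, which `l` kills, so only
    -- the factor `det (1 + ε X) ^ N` contributes to the derivative of `P`.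
    refine ⟨((dualMatrix 1 X).det ^ N).snd, fun g hg => ?_⟩
    have hgg : (g : Matrix n n k) * ((g⁻¹ : GL n k) : Matrix n n k) = 1 := by
      rw [← Units.val_mul, mul_inv_cancel, Units.val_one]
    have hgg' : ((g⁻¹ : GL n k) : Matrix n n k) * (g : Matrix n n k) = 1 := by
      rw [← Units.val_mul, inv_mul_cancel, Units.val_one]
    have hPg := hPk g
    set A := (g : Matrix n n k)
    set A' := ((g⁻¹ : GL n k) : Matrix n n k)
    have hmul : dualMatrix A (A * X) * dualMatrix A' (-(X * A')) = 1 := by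
      rw [dualMatrix_mul, ← dualMatrix_one, hgg]
      simp [mul_assoc]
    have h2 := hP _ _ _ hmul
    rw [map_algebraMap_eq_dualMatrix, dualMatrix_mul, dualMatrix_mul] at h2
    have h3 : A * b * -(X * A') + (A * 0 + A * X * b) * A' = ⁅A * X * A', A * b * A'⁆ := by
      have h : ∀ Z, A' * (A * Z) = Z := fun Z => by rw [← mul_assoc, hgg', one_mul]
      simp only [Ring.lie_def, mul_assoc, h, mul_zero, zero_add, mul_neg]
      abel
    have h4 : l ⁅A * X * A', A * b * A'⁆ = 0 :=
      hl _ (hD _ (conj_mem_lieAlg H hg hX) _ (conj_mem_lieAlg H hg hb))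
    rw [h3] at h2
    have h5 := (evalDual_mul A X P).symm.trans (h2.trans (congrArg _ (hqd _ _ h4)))
    have h6 : (dualMatrix A (A * X)).det = TrivSqZeroExt.inl A.det * (dualMatrix 1 X).det := by
      have : dualMatrix A (A * X) = dualMatrix A 0 * dualMatrix 1 X := by
        rw [dualMatrix_mul]; simp
      rw [this, Matrix.det_mul, ← map_algebraMap_eq_dualMatrix]
      congr 1
      exact (RingHom.map_det (algebraMap k (DualNumber k)) A).symm
    have h7 := congrArg TrivSqZeroExt.snd h5
    rw [h6, mul_pow, hq] at h7
    generalize (dualMatrix 1 X).det ^ N = δ at h7 ⊢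
    rw [hPg]
    simp only [TrivSqZeroExt.snd_add, TrivSqZeroExt.snd_inl, TrivSqZeroExt.snd_inr, zero_add] at h7
    rw [h7, TrivSqZeroExt.inl_pow]
    simp
    ring
  have h := evalAt_eq_zero_of_eigen hH hP1 hχ hs
  rw [hPk] at h
  rw [map_sub]
  exact (mul_eq_zero.1 h).resolve_left
    (pow_ne_zero _ ((Matrix.isUnit_iff_isUnit_det _).1 s.isUnit).ne_zero)

end

/-! ### The triangular decomposition of a semisimple Lie algebra -/

section

open LieAlgebra LieModule

variable {k L : Type*} [Field k] [CharZero k] [IsAlgClosed k] [LieRing L] [LieAlgebra k L]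
  [FiniteDimensional k L] [HasTrivialRadical k L]
  (t : LieSubalgebra k L) [t.IsCartanSubalgebra] (Δ : (IsKilling.rootSystem t).Base)

theorem rootSpace_le_posNilpotent {α : t.root} (hα : Δ.IsPos α) :
    (rootSpace t (α.1 : t → k)).toSubmodule ≤ posNilpotent t Δ :=
  le_iSup (fun α : {α : t.root // Δ.IsPos α} => (rootSpace t (α.1.1 : t → k)).toSubmodule) ⟨α, hα⟩

theorem coe_root_ne_zero (α : t.root) : (α.1 : t → k) ≠ 0 :=
  LieSubalgebra.isNonZero_coe_root α

theorem disjoint_cartan_posNilpotent : Disjoint t.toSubmodule (posNilpotent t Δ) := by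
  have h := LieSubmodule.iSupIndep_toSubmodule.mpr (iSupIndep_genWeightSpace k t L) 0
  have h0 : (genWeightSpace L (0 : t → k)).toSubmodule = t.toSubmodule := by
    have := rootSpace_zero_eq k L t
    rw [rootSpace] at this
    rw [this, LieSubalgebra.coe_toLieSubmodule]
  change Disjoint (genWeightSpace L (0 : t → k)).toSubmodule _ at h
  rw [h0] at h
  refine h.mono_right (iSup_le fun α => ?_)
  exact le_iSup₂_of_le (f := fun (χ : t → k) (_ : χ ≠ 0) => (genWeightSpace L χ).toSubmodule)
    (α.1.1 : t → k) (coe_root_ne_zero t α.1) le_rfl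

theorem lie_mem_posNilpotent_of_isPos {α β : t.root} (hα : Δ.IsPos α) (hβ : Δ.IsPos β) {x y : L}
    (hx : x ∈ rootSpace t (α.1 : t → k)) (hy : y ∈ rootSpace t (β.1 : t → k)) :
    ⁅x, y⁆ ∈ posNilpotent t Δ := by
  have h : ⁅x, y⁆ ∈ rootSpace t ((α.1 : t → k) + (β.1 : t → k)) :=
    lie_mem_genWeightSpace_of_mem_genWeightSpace hx hy
  by_cases hb : rootSpace t ((α.1 : t → k) + (β.1 : t → k)) = ⊥
  · rw [hb] at h
    rw [(LieSubmodule.mem_bot _).1 h]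
    exact zero_mem _
  let γ : Weight k t L := ⟨(α.1 : t → k) + (β.1 : t → k), hb⟩
  have hγ : γ.IsNonZero := by
    intro h0
    have h0' : (α.1 : t → k) + (β.1 : t → k) = 0 := h0
    -- If `α + β = 0`, then `α = β - 2 β` has the height `-height β`, which is negative.
    have h1 : (IsKilling.rootSystem t).root α =
        (IsKilling.rootSystem t).root β + (-2 : ℤ) • (IsKilling.rootSystem t).root β := by
      ext τ
      have := congrFun h0' τ
      simp only [Pi.add_apply, Pi.zero_apply] at this
      simp
      linear_combination this
    have h2 := Δ.height_add_zsmul h1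
    rw [RootPairing.Base.isPos_iff] at hα hβ
    simp at h2
    omega
  let γ' : t.root := ⟨γ, by simpa [LieSubalgebra.root] using hγ⟩
  have hpos : Δ.IsPos γ' := RootPairing.Base.IsPos.add hα hβ (by ext τ; rfl)
  exact rootSpace_le_posNilpotent t Δ hpos h

theorem lie_cartan_mem_posNilpotent (τ : t) {x : L} (hx : x ∈ posNilpotent t Δ) :
    ⁅(τ : L), x⁆ ∈ posNilpotent t Δ := by
  refine Submodule.iSup_induction _ (motive := fun x => ⁅(τ : L), x⁆ ∈ posNilpotent t Δ) hx
    (fun α x hx => ?_) (by simp) (fun x y hx hy => by rw [lie_add]; exact add_mem hx hy)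
  exact rootSpace_le_posNilpotent t Δ α.2 ((rootSpace t (α.1.1 : t → k)).lie_mem (x := τ) hx)

theorem lie_posNilpotent_mem_posNilpotent {x y : L} (hx : x ∈ posNilpotent t Δ)
    (hy : y ∈ posNilpotent t Δ) : ⁅x, y⁆ ∈ posNilpotent t Δ := by
  refine Submodule.iSup_induction _ (motive := fun x => ⁅x, y⁆ ∈ posNilpotent t Δ) hx
    (fun α x hx => ?_) (by simp) (fun x y hx hy => by rw [add_lie]; exact add_mem hx hy)
  refine Submodule.iSup_induction _ (motive := fun y => ⁅x, y⁆ ∈ posNilpotent t Δ) hy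
    (fun β y hy => ?_) (by simp) (fun x y hx hy => by rw [lie_add]; exact add_mem hx hy)
  exact lie_mem_posNilpotent_of_isPos t Δ α.2 β.2 hx hy

/-- The derived algebra of the Borel subalgebra `𝔱 ⊕ 𝔲` is contained in `𝔲`. -/
theorem lie_mem_posNilpotent {x y : L} (hx : x ∈ t.toSubmodule ⊔ posNilpotent t Δ)
    (hy : y ∈ t.toSubmodule ⊔ posNilpotent t Δ) : ⁅x, y⁆ ∈ posNilpotent t Δ := by
  obtain ⟨τ, hτ, u, hu, rfl⟩ := Submodule.mem_sup.1 hx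
  obtain ⟨σ, hσ, v, hv, rfl⟩ := Submodule.mem_sup.1 hy
  have h0 : ⁅τ, σ⁆ = 0 := congrArg Subtype.val (trivial_lie_zero t t ⟨τ, hτ⟩ ⟨σ, hσ⟩)
  rw [add_lie, lie_add, lie_add, h0, zero_add, ← lie_skew u σ]
  exact add_mem (lie_cartan_mem_posNilpotent t Δ ⟨τ, hτ⟩ hv)
    (add_mem (neg_mem (lie_cartan_mem_posNilpotent t Δ ⟨σ, hσ⟩ hu))
      (lie_posNilpotent_mem_posNilpotent t Δ hu hv))

theorem exists_regular : ∃ τ : t, ∀ α : t.root, α.1 τ ≠ 0 := by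
  refine Module.Dual.exists_forall_ne_zero_of_forall_exists
    (fun α : t.root => Weight.toLinear k t L α.1) fun α => ?_
  by_contra! h
  exact coe_root_ne_zero t α (funext h)

variable {t} in
theorem exists_lie_eq_of_mem_rootSpace {τ : t} {α : t.root} (hτ : α.1 τ ≠ 0) {x : L}
    (hx : x ∈ rootSpace t (α.1 : t → k)) :
    ∃ y ∈ rootSpace t (α.1 : t → k), ⁅(τ : L), y⁆ = x := by
  refine ⟨(α.1 τ)⁻¹ • x, (rootSpace t (α.1 : t → k)).smul_mem _ hx, ?_⟩
  have h := IsKilling.lie_eq_smul_of_mem_rootSpace hx τ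
  rw [LieSubalgebra.coe_bracket_of_module] at h
  rw [lie_smul, h, smul_smul, inv_mul_cancel₀ hτ, one_smul]

variable {t} in
theorem exists_lie_eq_of_mem_posNilpotent {τ : t} (hτ : ∀ α : t.root, α.1 τ ≠ 0) {x : L}
    (hx : x ∈ posNilpotent t Δ) : ∃ y ∈ posNilpotent t Δ, ⁅(τ : L), y⁆ = x := by
  refine Submodule.iSup_induction _
    (motive := fun x => ∃ y ∈ posNilpotent t Δ, ⁅(τ : L), y⁆ = x) hx
    (fun α x hx => ?_) ⟨0, zero_mem _, lie_zero _⟩ ?_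
  · obtain ⟨y, hy, h⟩ := exists_lie_eq_of_mem_rootSpace (hτ α.1) hx
    exact ⟨y, rootSpace_le_posNilpotent t Δ α.2 hy, h⟩
  · rintro _ _ ⟨y, hy, rfl⟩ ⟨z, hz, rfl⟩
    exact ⟨y + z, add_mem hy hz, lie_add _ _ _⟩

variable {t} in
theorem exists_sub_lie_mem_borel {τ : t} (hτ : ∀ α : t.root, α.1 τ ≠ 0) (x : L) :
    ∃ y, x - ⁅(τ : L), y⁆ ∈ t.toSubmodule ⊔ posNilpotent t Δ := by
  have htop := LieSubmodule.iSup_toSubmodule_eq_top.mpr (iSup_genWeightSpace_eq_top' k t L)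
  have hx : x ∈ ⨆ χ : Weight k t L, (genWeightSpace L χ).toSubmodule := htop ▸ trivial
  refine Submodule.iSup_induction _
    (motive := fun x => ∃ y, x - ⁅(τ : L), y⁆ ∈ t.toSubmodule ⊔ posNilpotent t Δ) hx
    (fun χ x hx => ?_) ⟨0, by simp⟩ ?_
  · by_cases hχ : χ.IsNonZero
    · obtain ⟨y, -, h⟩ := exists_lie_eq_of_mem_rootSpace (α := ⟨χ, by
        simpa [LieSubalgebra.root] using hχ⟩) (hτ _) hx
      exact ⟨y, by rw [h, sub_self]; exact zero_mem _⟩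
    · have h0 : (χ : t → k) = 0 := not_not.1 hχ
      rw [h0] at hx
      have := rootSpace_zero_eq k L t
      rw [rootSpace] at this
      rw [this] at hx
      exact ⟨0, by simpa using Submodule.mem_sup_left hx⟩
  · rintro x x' ⟨y, hy⟩ ⟨z, hz⟩
    refine ⟨y + z, ?_⟩
    convert add_mem hy hz using 1
    rw [lie_add]
    abel

end

/-! ### Polynomial functions -/

section

variable {k : Type*} [Field k] {V W : Type*} [AddCommGroup V] [Module k V] [AddCommGroup W]
  [Module k W]

theorem dual_mem_polyFun (φ : Module.Dual k V) : (φ : V → k) ∈ polyFun k V :=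
  Algebra.subset_adjoin ⟨φ, rfl⟩

/-- Composition with a map, as an algebra homomorphism between algebras of functions. -/
def compHom (k : Type*) [Field k] {V W : Type*} (φ : V → W) : (W → k) →ₐ[k] (V → k) where
  toFun f := f ∘ φ
  map_one' := rfl
  map_mul' _ _ := rfl
  map_zero' := rfl
  map_add' _ _ := rfl
  commutes' _ := rfl

theorem comp_mem_polyFun (φ : V →ₗ[k] W) {f : W → k} (hf : f ∈ polyFun k W) :
    f ∘ φ ∈ polyFun k V := by
  have h : polyFun k W ≤ (polyFun k V).comap (compHom k φ) := by
    rw [polyFun, Algebra.adjoin_le_iff]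
    rintro _ ⟨ψ, rfl⟩
    exact dual_mem_polyFun (ψ ∘ₗ φ)
  exact h hf

/-- A polynomial function restricts to a polynomial in one variable on every line. -/
theorem exists_polynomial_line {f : V → k} (hf : f ∈ polyFun k V) (x y : V) :
    ∃ P : Polynomial k, ∀ c : k, f (x + c • y) = P.eval c := by
  induction hf using Algebra.adjoin_induction with
  | mem f hf =>
    obtain ⟨φ, rfl⟩ := hf
    exact ⟨Polynomial.C (φ x) + Polynomial.C (φ y) * Polynomial.X, fun c => by
      simp; ring⟩
  | algebraMap a => exact ⟨Polynomial.C a, fun c => by simp⟩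
  | add f g _ _ hf hg =>
    obtain ⟨P, hP⟩ := hf
    obtain ⟨Q, hQ⟩ := hg
    exact ⟨P + Q, fun c => by simp [hP, hQ]⟩
  | mul f g _ _ hf hg =>
    obtain ⟨P, hP⟩ := hf
    obtain ⟨Q, hQ⟩ := hg
    exact ⟨P * Q, fun c => by simp [hP, hQ]⟩

theorem eq_of_eventually_eq_line [Infinite k] {f g : V → k} (hf : f ∈ polyFun k V)
    (hg : g ∈ polyFun k V) (x x' y y' : V)
    (h : {c : k | f (x + c • y) ≠ g (x' + c • y')}.Finite) : f x = g x' := by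
  obtain ⟨P, hP⟩ := exists_polynomial_line hf x y
  obtain ⟨Q, hQ⟩ := exists_polynomial_line hg x' y'
  have h1 : P = Q := by
    refine Polynomial.eq_of_infinite_eval_eq P Q ?_
    convert h.infinite_compl using 1
    ext c
    simp [hP, hQ]
  have h2 := hP 0
  have h3 := hQ 0
  rw [zero_smul, add_zero] at h2 h3
  rw [h2, h3, h1]

/-- A polynomial function on a space of matrices is given by a polynomial in the entries. -/
theorem exists_evalAt_eq {n : Type*} [Fintype n] [DecidableEq n] (ι : V →ₗ[k] Matrix n n k)
    (hι : Function.Injective ι) {f : V → k} (hf : f ∈ polyFun k V) :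
    ∃ q : MvPolynomial (n × n) k, ∀ v, f v = evalAt (ι v) q := by
  induction hf using Algebra.adjoin_induction with
  | mem f hf =>
    obtain ⟨φ, rfl⟩ := hf
    obtain ⟨r, hr⟩ := ι.exists_leftInverse_of_injective (LinearMap.ker_eq_bot.2 hι)
    refine ⟨∑ i, ∑ j, MvPolynomial.C (φ (r (Matrix.single i j 1))) * MvPolynomial.X (i, j),
      fun v => ?_⟩
    have hv : v = r (ι v) := (DFunLike.congr_fun hr v).symm
    conv_lhs => rw [hv, Matrix.matrix_eq_sum_single (ι v)]
    simp only [evalAt, map_sum, map_mul, MvPolynomial.aeval_X, MvPolynomial.aeval_C]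
    refine Finset.sum_congr rfl fun i _ => Finset.sum_congr rfl fun j _ => ?_
    rw [← mul_one (ι v i j), ← smul_eq_mul, ← Matrix.smul_single, map_smul, map_smul, smul_eq_mul,
      smul_eq_mul, mul_one, mul_comm]
    rfl
  | algebraMap a => exact ⟨MvPolynomial.C a, fun v => by simp [evalAt]⟩
  | add f g _ _ hf hg =>
    obtain ⟨P, hP⟩ := hf
    obtain ⟨Q, hQ⟩ := hg
    exact ⟨P + Q, fun v => by simp [hP, hQ]⟩
  | mul f g _ _ hf hg =>
    obtain ⟨P, hP⟩ := hf
    obtain ⟨Q, hQ⟩ := hg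
    exact ⟨P * Q, fun v => by simp [hP, hQ]⟩

/-- A basis of the dual space is a system of polynomial coordinates. -/
theorem exists_mvPolynomial_equiv_polyFun [Infinite k] [FiniteDimensional k V] {ι : Type*}
    (c : Module.Basis ι k (Module.Dual k V)) :
    ∃ e : MvPolynomial ι k ≃ₐ[k] polyFun k V, ∀ i v, (e (MvPolynomial.X i) : V → k) v = c i v := by
  let φ : MvPolynomial ι k →ₐ[k] polyFun k V :=
    MvPolynomial.aeval fun i => ⟨c i, dual_mem_polyFun (c i)⟩
  have hval : ∀ P v, (φ P : V → k) v = MvPolynomial.eval (fun i => c i v) P := by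
    intro P v
    have h : ((Pi.evalAlgHom k (fun _ : V => k) v).comp ((polyFun k V).val.comp φ)) =
        MvPolynomial.aeval (fun i => c i v) := by
      ext i
      simp [φ]
    exact (DFunLike.congr_fun h P).trans (by rw [MvPolynomial.aeval_eq_eval])
  have hinj : Function.Injective φ := by
    intro P Q h
    refine MvPolynomial.funext fun y => ?_
    have hy : ∀ i, c i ((Module.evalEquiv k V).symm (c.constr k y)) = y i := by
      intro i
      rw [Module.apply_evalEquiv_symm_apply, Module.Basis.constr_basis]
    have h1 := congrFun (congrArg Subtype.val h) ((Module.evalEquiv k V).symm (c.constr k y))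
    rw [hval, hval] at h1
    simpa only [hy] using h1
  have hsurj : Function.Surjective φ := by
    have h : polyFun k V ≤ ((polyFun k V).val.comp φ).range := by
      refine Algebra.adjoin_le_iff.2 ?_
      rintro _ ⟨ψ, rfl⟩
      refine ⟨(c.repr ψ).sum fun i a => MvPolynomial.C a * MvPolynomial.X i, ?_⟩
      ext v
      refine (hval _ v).trans ?_
      conv_rhs => rw [← c.linearCombination_repr ψ]
      simp [Finsupp.linearCombination_apply, Finsupp.sum]
    rintro ⟨f, hf⟩
    obtain ⟨P, hP⟩ := h hf
    exact ⟨P, Subtype.ext hP⟩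
  exact ⟨AlgEquiv.ofBijective φ ⟨hinj, hsurj⟩, fun i v => (hval _ v).trans (by simp)⟩

/-- If `N` is invertible, then `M + c N` is invertible for all but finitely many `c`. -/
theorem finite_not_surjective_add_smul [FiniteDimensional k V] (M N : Module.End k V)
    (hN : Function.Surjective N) : {c : k | ¬ Function.Surjective (M + c • N)}.Finite := by
  let e := LinearEquiv.ofBijective N ⟨LinearMap.injective_iff_surjective.2 hN, hN⟩
  have heN : ∀ v, e.symm (N v) = v := e.symm_apply_apply
  refine (Module.End.finite_hasEigenvalue (-(e.symm.toLinearMap ∘ₗ M))).subset fun c hc => ?_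
  rw [Set.mem_ofPred_eq, ← LinearMap.injective_iff_surjective, ← LinearMap.ker_eq_bot] at hc
  obtain ⟨v, hv, hv0⟩ := Submodule.exists_mem_ne_zero_of_ne_bot hc
  refine Module.End.hasEigenvalue_of_hasEigenvector (x := v) ⟨?_, hv0⟩
  rw [Module.End.mem_eigenspace_iff]
  have h := congrArg e.symm (LinearMap.mem_ker.1 hv)
  simp only [LinearMap.add_apply, LinearMap.smul_apply, map_add, map_smul, heN, map_zero] at h
  simpa using neg_eq_of_add_eq_zero_right h

end

section

variable {k : Type*} [Field k] {n : Type*} [Fintype n] [DecidableEq n]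

/-- The derivative in the constant direction `X` of a polynomial in the matrix entries. -/
def dirDer (X : Matrix n n k) :
    Derivation k (MvPolynomial (n × n) k) (MvPolynomial (n × n) k) :=
  MvPolynomial.mkDerivation k fun ij => MvPolynomial.C (X ij.1 ij.2)

theorem evalDual_eq (A X : Matrix n n k) (p : MvPolynomial (n × n) k) :
    evalDual A X p =
      TrivSqZeroExt.inl (evalAt A p) + TrivSqZeroExt.inr (evalAt A (dirDer X p)) := by
  induction p using MvPolynomial.induction_on with
  | C a =>
    rw [← MvPolynomial.algebraMap_eq, AlgHom.commutes, AlgHom.commutes, Derivation.map_algebraMap]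
    ext <;> simp [TrivSqZeroExt.algebraMap_eq_inl]
  | add p q hp hq => rw [map_add, hp, hq]; ext <;> simp
  | mul_X p i hp =>
    rw [map_mul, hp]
    have h1 : evalDual A X (MvPolynomial.X i) =
        TrivSqZeroExt.inl (A i.1 i.2) + TrivSqZeroExt.inr (X i.1 i.2) := by
      simp [evalDual]
    have h2 : evalAt A (MvPolynomial.X i) = A i.1 i.2 := by simp [evalAt]
    have h3 : evalAt A (dirDer X (MvPolynomial.X i)) = X i.1 i.2 := by
      simp [dirDer, MvPolynomial.mkDerivation_X, evalAt]
    rw [h1]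
    ext
    · simp [h2]
    · simp [h2, h3]; ring

theorem exists_polynomial_evalAt_line (p : MvPolynomial (n × n) k) (A X : Matrix n n k) :
    ∃ P : Polynomial k, ∀ c : k, evalAt (A + c • X) p = P.eval c ∧
      evalAt (A + c • X) (dirDer X p) = P.derivative.eval c := by
  induction p using MvPolynomial.induction_on with
  | C a =>
    refine ⟨Polynomial.C a, fun c => ?_⟩
    rw [← MvPolynomial.algebraMap_eq, Derivation.map_algebraMap]
    simp [evalAt]
  | add p q hp hq =>
    obtain ⟨P, hP⟩ := hp
    obtain ⟨Q, hQ⟩ := hq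
    exact ⟨P + Q, fun c => by simp [hP, hQ]⟩
  | mul_X p i hp =>
    obtain ⟨P, hP⟩ := hp
    refine ⟨P * (Polynomial.C (A i.1 i.2) + Polynomial.C (X i.1 i.2) * Polynomial.X), fun c => ?_⟩
    have h2 : evalAt (A + c • X) (MvPolynomial.X i) = A i.1 i.2 + c * X i.1 i.2 := by simp [evalAt]
    have h3 : evalAt (A + c • X) (dirDer X (MvPolynomial.X i)) = X i.1 i.2 := by
      simp [dirDer, MvPolynomial.mkDerivation_X, evalAt]
    constructor
    · rw [map_mul, (hP c).1, h2, Polynomial.eval_mul]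
      congr 1
      simp; ring
    · simp [hP, h2, h3]; ring

theorem evalAt_eq_zero_of_finite_ne_zero [Infinite k] (p : MvPolynomial (n × n) k)
    (A X : Matrix n n k) (h : {c : k | evalAt (A + c • X) p ≠ 0}.Finite) : evalAt A p = 0 := by
  obtain ⟨P, hP⟩ := exists_polynomial_evalAt_line p A X
  have h1 : P = 0 := by
    refine Polynomial.eq_zero_of_infinite_isRoot P ?_
    convert h.infinite_compl using 1
    ext c
    simp [hP]
  simpa [h1] using (hP 0).1

theorem evalAt_add_eq_of_dirDer_eq_zero [CharZero k] (p : MvPolynomial (n × n) k)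
    (A X : Matrix n n k) (h : ∀ c : k, evalAt (A + c • X) (dirDer X p) = 0) :
    evalAt (A + X) p = evalAt A p := by
  obtain ⟨P, hP⟩ := exists_polynomial_evalAt_line p A X
  have h1 : P.derivative = 0 := Polynomial.funext fun c => by
    rw [← (hP c).2, h c, Polynomial.eval_zero]
  have h2 := Polynomial.eq_C_of_natDegree_eq_zero (Polynomial.derivative_eq_zero.1 h1)
  have h3 := (hP 0).1
  have h4 := (hP 1).1
  rw [h2, Polynomial.eval_C] at h3 h4
  rw [zero_smul, add_zero] at h3
  rw [one_smul] at h4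
  rw [h3, h4]

end

/-! ### Invariants of the contraction -/

section

variable {k : Type*} [Field k] {n : Type*} [Fintype n] [DecidableEq n] {G B : Subgroup (GL n k)}

theorem lieAlg_mono (h : B ≤ G) : lieAlg B ≤ lieAlg G := fun _ hX p hp =>
  hX p fun g hg => hp g (h hg)

theorem invariants_apply_inr (hBG : B ≤ G) {f : Contr G B → k} (hf : f ∈ invariants (AdQ hBG))
    (s : B) (b : subLie G B) : f (AdSub hBG s b, 0) = f (b, 0) := by
  have h := hf.2 (SemidirectProduct.inr s * SemidirectProduct.inl (Multiplicative.ofAdd 0)) (b, 0)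
  rw [AdQ_inr_mul_inl] at h
  simpa using h

theorem invariants_apply_inl (hBG : B ≤ G) {f : Contr G B → k} (hf : f ∈ invariants (AdQ hBG))
    (b : subLie G B) (v w : QuotSpace G B) : f (b, w - circ G B b v) = f (b, w) := by
  have h := hf.2 (SemidirectProduct.inr 1 * SemidirectProduct.inl (Multiplicative.ofAdd v)) (b, w)
  rw [AdQ_inr_mul_inl] at h
  simpa using h

/-- Invariants do not depend on the component in `𝔤/𝔟`: for generic `b` the map `v ↦ b ∘ v` is
surjective, so that the orbit of `(b, w)` under `exp((𝔤/𝔟)ᵃ)` is `{b} × 𝔤/𝔟`. -/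
theorem invariants_apply_eq_zero_right [CharZero k] (hBG : B ≤ G) {f : Contr G B → k}
    (hf : f ∈ invariants (AdQ hBG)) {τ : subLie G B} (hτ : Function.Surjective (circ G B τ))
    (b : subLie G B) (w : QuotSpace G B) : f (b, w) = f (b, 0) := by
  refine eq_of_eventually_eq_line hf.1 hf.1 (b, w) (b, 0) (τ, 0) (τ, 0)
    ((finite_not_surjective_add_smul (circ G B b) (circ G B τ) hτ).subset fun c hc hs => hc ?_)
  obtain ⟨v, hv⟩ := hs w
  have h := invariants_apply_inl hBG hf (b + c • τ) v w
  rw [map_add, map_smul, hv, sub_self] at h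
  simpa using h.symm

variable [IsAlgClosed k] [CharZero k] [LieAlgebra.HasTrivialRadical k (lieAlg G)]
  {t : LieSubalgebra k (lieAlg G)} [t.IsCartanSubalgebra]
  {Δ : (LieAlgebra.IsKilling.rootSystem t).Base}

/-- The group `B` acts trivially on `𝔟/𝔲`. -/
theorem AdSub_sub_mem (hBG : B ≤ G) (hB : IsZariskiConnected (B : Set (GL n k)))
    (hLieB : (subLie G B).toSubmodule = t.toSubmodule ⊔ posNilpotent t Δ)
    (s : B) (b : subLie G B) :
    (AdSub hBG s b : lieAlg G) - (b : lieAlg G) ∈ posNilpotent t Δ := by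
  have hmem : ∀ X (hX : X ∈ lieAlg B), (⟨X, lieAlg_mono hBG hX⟩ : lieAlg G) ∈
      t.toSubmodule ⊔ posNilpotent t Δ := by
    intro X hX
    rw [← hLieB]
    exact hX
  have h := conj_sub_mem hB ((posNilpotent t Δ).map (lieAlg G).toSubmodule.subtype)
    (fun X hX Y hY => ⟨⁅⟨X, lieAlg_mono hBG hX⟩, ⟨Y, lieAlg_mono hBG hY⟩⁆,
      lie_mem_posNilpotent t Δ (hmem X hX) (hmem Y hY), rfl⟩) (b := ((b : lieAlg G) : Matrix n n k))
      b.2 s.2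
  obtain ⟨y, hy, h⟩ := h
  have h' : y = (AdSub hBG s b : lieAlg G) - (b : lieAlg G) := Subtype.ext h
  rwa [h'] at hy

/-- The derivative of an `Ad(B)`-invariant polynomial on `𝔟` vanishes in the directions of `𝔲`:
in the direction `[X, b]` it does by invariance, and `[𝔲, b] = 𝔲` for generic `b`. -/
theorem evalAt_dirDer_eq_zero
    (hLieB : (subLie G B).toSubmodule = t.toSubmodule ⊔ posNilpotent t Δ)
    {q : MvPolynomial (n × n) k}
    (hq : ∀ b ∈ subLie G B, ∀ X ∈ subLie G B,
      evalAt (b : Matrix n n k) (dirDer (⁅X, b⁆ : lieAlg G) q) = 0)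
    {b v : lieAlg G} (hb : b ∈ subLie G B) (hv : v ∈ posNilpotent t Δ) :
    evalAt (b : Matrix n n k) (dirDer (v : Matrix n n k) q) = 0 := by
  have hmem : ∀ x, x ∈ subLie G B ↔ x ∈ t.toSubmodule ⊔ posNilpotent t Δ := fun x => by
    rw [← hLieB]; rfl
  obtain ⟨τ, hτ⟩ := exists_regular t
  have hτB : (τ : lieAlg G) ∈ subLie G B := (hmem _).2 (Submodule.mem_sup_left τ.2)
  have hres : ∀ b ∈ subLie G B, ∀ x ∈ posNilpotent t Δ,
      LieAlgebra.ad k (lieAlg G) b x ∈ posNilpotent t Δ := fun b hb x hx =>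
    lie_mem_posNilpotent t Δ ((hmem b).1 hb) (Submodule.mem_sup_right hx)
  have hsurj : Function.Surjective ((LieAlgebra.ad k (lieAlg G) τ).restrict (hres τ hτB)) := by
    rintro ⟨x, hx⟩
    obtain ⟨y, hy, h⟩ := exists_lie_eq_of_mem_posNilpotent Δ hτ hx
    exact ⟨⟨y, hy⟩, Subtype.ext h⟩
  refine evalAt_eq_zero_of_finite_ne_zero _ _ ((τ : lieAlg G) : Matrix n n k)
    ((finite_not_surjective_add_smul ((LieAlgebra.ad k (lieAlg G) b).restrict (hres b hb))
      _ hsurj).subset fun c hc hs => hc ?_)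
  obtain ⟨x, hx⟩ := hs ⟨v, hv⟩
  have hx' : ⁅b, (x : lieAlg G)⁆ + c • ⁅(τ : lieAlg G), (x : lieAlg G)⁆ = v :=
    congrArg Subtype.val hx
  have h := hq (b + c • (τ : lieAlg G)) (add_mem hb ((subLie G B).smul_mem c hτB)) (-x)
    (neg_mem ((hmem _).2 (Submodule.mem_sup_right x.2)))
  rw [neg_lie, lie_skew, add_lie, smul_lie, hx'] at h
  exact h

/-- Invariants depend only on the component in `𝔱`. -/
theorem invariants_apply_eq (hBG : B ≤ G)
    (hLieB : (subLie G B).toSubmodule = t.toSubmodule ⊔ posNilpotent t Δ)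
    {f : Contr G B → k} (hf : f ∈ invariants (AdQ hBG)) {b b' : subLie G B}
    (hb : (b : lieAlg G) - b' ∈ posNilpotent t Δ) (w : QuotSpace G B) : f (b, w) = f (b', 0) := by
  have hmem : ∀ x, x ∈ subLie G B ↔ x ∈ t.toSubmodule ⊔ posNilpotent t Δ := fun x => by
    rw [← hLieB]; rfl
  obtain ⟨τ, hτ⟩ := exists_regular t
  have hτB : (τ : lieAlg G) ∈ subLie G B := (hmem _).2 (Submodule.mem_sup_left τ.2)
  have hsurj : Function.Surjective (circ G B ⟨τ, hτB⟩) := by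
    intro v
    obtain ⟨x, rfl⟩ := Submodule.Quotient.mk_surjective _ v
    obtain ⟨y, hy⟩ := exists_sub_lie_mem_borel Δ hτ x
    refine ⟨Submodule.Quotient.mk y, ?_⟩
    rw [circ_mk, eq_comm, Submodule.Quotient.eq]
    exact (hmem _).2 hy
  rw [invariants_apply_eq_zero_right hBG hf hsurj]
  obtain ⟨q, hq⟩ := exists_evalAt_eq
    ((lieAlg G).toSubmodule.subtype ∘ₗ (subLie G B).toSubmodule.subtype)
    (Subtype.val_injective.comp Subtype.val_injective)
    (comp_mem_polyFun (LinearMap.inl k (subLie G B) (QuotSpace G B)) hf.1)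
  replace hq : ∀ b : subLie G B, f (b, 0) = evalAt ((b : lieAlg G) : Matrix n n k) q := hq
  have hder : ∀ b ∈ subLie G B, ∀ X ∈ subLie G B,
      evalAt (b : Matrix n n k) (dirDer (⁅X, b⁆ : lieAlg G) q) = 0 := by
    intro b hb X hX
    have h := evalDual_lie_of_invariant B (b := (b : Matrix n n k)) (q := q) (fun s hs => by
      have h := invariants_apply_inr hBG hf ⟨s, hs⟩ ⟨b, hb⟩
      rw [hq, hq] at h
      exact h) hX
    rw [evalDual_eq] at h
    simpa using congrArg TrivSqZeroExt.snd h
  have h := evalAt_add_eq_of_dirDer_eq_zero q ((b' : lieAlg G) : Matrix n n k)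
    (((b : lieAlg G) - b' : lieAlg G) : Matrix n n k) fun c =>
      evalAt_dirDer_eq_zero hLieB hder
        (b := (b' : lieAlg G) + c • ((b : lieAlg G) - b')) (add_mem b'.2
          ((subLie G B).smul_mem c (sub_mem b.2 b'.2))) hb
  rw [hq, hq, ← h]
  simp

variable (t Δ) in
/-- The projection of `𝔤` to `𝔱` along a complement of `𝔱` which contains `𝔲`. -/
theorem exists_projection : ∃ r : lieAlg G →ₗ[k] t,
    (∀ τ : t, r τ = τ) ∧ ∀ u ∈ posNilpotent t Δ, r u = 0 := by
  obtain ⟨r, hr⟩ := ((posNilpotent t Δ).mkQ ∘ₗ t.toSubmodule.subtype).exists_leftInverse_of_injective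
    (by
      rw [LinearMap.ker_comp, Submodule.ker_mkQ]
      exact Submodule.disjoint_iff_comap_eq_bot.1 (disjoint_cartan_posNilpotent t Δ))
  refine ⟨r ∘ₗ (posNilpotent t Δ).mkQ, fun τ => DFunLike.congr_fun hr τ, fun u hu => ?_⟩
  rw [LinearMap.comp_apply, Submodule.mkQ_apply, (Submodule.Quotient.mk_eq_zero _).2 hu, map_zero]

end

end Contraction

end

theorem mainTheorem4
    {k : Type*} [Field k] [IsAlgClosed k] [CharZero k]
    {n : Type*} [Fintype n] [DecidableEq n]
    (G : Subgroup (GL n k))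
    (hG : Contraction.IsZariskiClosed (G : Set (GL n k)))
    (hGconn : Contraction.IsZariskiConnected (G : Set (GL n k)))
    [LieAlgebra.HasTrivialRadical k (Contraction.lieAlg G)]
    (t : LieSubalgebra k (Contraction.lieAlg G)) [t.IsCartanSubalgebra]
    (Δ : (LieAlgebra.IsKilling.rootSystem t).Base)
    (B : Subgroup (GL n k)) (hBG : B ≤ G)
    (hB : Contraction.IsZariskiClosed (B : Set (GL n k)))
    (hBconn : Contraction.IsZariskiConnected (B : Set (GL n k)))
    (hLieB : (Contraction.subLie G B).toSubmodule =
      t.toSubmodule ⊔ Contraction.posNilpotent t Δ) :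
    ∃ π : Contraction.Contr G B →ₗ[k] t,
      (∀ (x : Contraction.Contr G B) (τ : t), ∀ u ∈ Contraction.posNilpotent t Δ,
        (x.1 : Contraction.lieAlg G) = (τ : Contraction.lieAlg G) + u → π x = τ) ∧
      (∃ e : Contraction.polyFun k t ≃ₐ[k] Contraction.invariants (Contraction.AdQ hBG),
        ∀ (p : Contraction.polyFun k t) (x : Contraction.Contr G B),
          (e p : Contraction.Contr G B → k) x = (p : t → k) (π x)) ∧
      (∀ c : Module.Basis (Fin (Module.finrank k t)) k (Module.Dual k t),
        ∃ e : MvPolynomial (Fin (Module.finrank k t)) k ≃ₐ[k]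
            Contraction.invariants (Contraction.AdQ hBG),
          ∀ (i : Fin (Module.finrank k t)) (x : Contraction.Contr G B),
            (e (MvPolynomial.X i) : Contraction.Contr G B → k) x = c i (π x)) := by
  open Contraction in
  have htB : t.toSubmodule ≤ (subLie G B).toSubmodule := hLieB ▸ le_sup_left
  obtain ⟨r, hrt, hru⟩ := exists_projection t Δ
  let π : Contr G B →ₗ[k] t :=
    r ∘ₗ (subLie G B).toSubmodule.subtype ∘ₗ LinearMap.fst k (subLie G B) (QuotSpace G B)
  have hπ : ∀ x, π x = r (x.1 : lieAlg G) := fun _ => rfl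
  let σ : t →ₗ[k] Contr G B := LinearMap.inl k (subLie G B) (QuotSpace G B) ∘ₗ
    Submodule.inclusion htB
  have hπσ : ∀ τ, π (σ τ) = τ := hrt
  have hinv : ∀ γ x, π (AdQ hBG γ x) = π x := by
    intro γ x
    have h := hru _ (AdSub_sub_mem hBG hBconn hLieB γ.right x.1)
    rw [map_sub, sub_eq_zero] at h
    exact h
  let Φ : polyFun k t →ₐ[k] invariants (AdQ hBG) :=
    ((compHom k π).comp (polyFun k t).val).codRestrict _ fun p =>
      ⟨comp_mem_polyFun π p.2, fun γ x => congrArg (p : t → k) (hinv γ x)⟩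
  have hΦ : Function.Bijective Φ := by
    constructor
    · intro p p' h
      refine Subtype.ext (funext fun τ => ?_)
      have h' := congrFun (congrArg Subtype.val h) (σ τ)
      change (p : t → k) (π (σ τ)) = (p' : t → k) (π (σ τ)) at h'
      rwa [hπσ] at h'
    · rintro ⟨f, hf⟩
      refine ⟨⟨f ∘ σ, comp_mem_polyFun σ hf.1⟩, Subtype.ext (funext fun x => ?_)⟩
      refine (invariants_apply_eq hBG hLieB hf ?_ x.2).symm
      change (x.1 : lieAlg G) - (π x : t) ∈ posNilpotent t Δ
      obtain ⟨τ, hτ, u, hu, h⟩ := Submodule.mem_sup.1 (hLieB ▸ x.1.2 :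
        (x.1 : lieAlg G) ∈ t.toSubmodule ⊔ posNilpotent t Δ)
      have hτ' : π x = ⟨τ, hτ⟩ := by
        rw [hπ, ← h, map_add, hru u hu, add_zero]
        exact hrt ⟨τ, hτ⟩
      rw [hτ', ← h]
      simpa using hu
  refine ⟨π, ?_, ⟨AlgEquiv.ofBijective Φ hΦ, fun p x => rfl⟩, fun c => ?_⟩
  · intro x τ u hu h
    rw [hπ, h, map_add, hrt, hru u hu, add_zero]
  · obtain ⟨e, he⟩ := exists_mvPolynomial_equiv_polyFun c
    exact ⟨e.trans (AlgEquiv.ofBijective Φ hΦ), fun i x => he i (π x)⟩
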